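/- Let $\mathcal A$ be a finite alphabet with two distinct letters $a,b$. A code is a set $C\subseteq\mathcal A^*$ such that $x_1\cdots x_t=y_1\cdots y_{t'}$ with all $x_i,y_j\in C$ implies $t=t'$ and $x_i=y_i$ for all $i$. A finite maximal code is a finite code not properly contained in another code over $\mathcal A$. A prefix (suffix) code is a set of words, different from $\{\varepsilon\}$, none of whose words is a prefix (suffix) of another one. Prefix-suffix codes are defined recursively: the alphabet $\mathcal A$ is one, and if $C$ is one, then so is every $C'\subseteq C^*$ which is a prefix code or a suffix code when its elements are written as words over the alphabet $C$. Write $[m]=\{0,\dots,m-1\}$. For $n\ge 1$, an $n$-cbc (complete bayonet code) is a set $X\subseteq a^{[n]}ba^{[n]}$ with $n$ elements such that $\{a^n\}\cup X$ is a code. For $M\subseteq \mathcal A^*$ and $\omega\in\mathcal A^*$ let $$C_M(\omega)=\{a^{i \bmod n}\,b\,a^{j\bmod n} : i,j\ge 0,\ a^i\omega a^j\in M^*\}.$$ For a set $X$ of bayonet words $a^iba^j$ its dual is $\delta(X)=\{a^jba^i : a^iba^j\in X\}$. For a set $X\subseteq a^{[m]}ba^{[m]}$ with $m$ elements and $t\ge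 1$, $H_t(X)$ is the collection of all sets $$\{a^{i+k_{x,s}m}\,b\,a^{j+sm} : x=a^iba^j\in X,\ s\in[t]\},\qquad k_{x,s}\in[t].$$ The Hajós cbc of size $n$ are the elements of $H_n$, where $H_1=\{\{b\}\}$ and, for $n>1$, $H_n$ consists of all $Y$ and $\delta(Y)$ with $Y\in H_t(X)$, $X\in H_m$, $n=tm$, $t>1$. For $r\in[n]$ put $X\circ_r Y=\{a^iba^l : a^iba^j\in X,\ a^kba^l\in Y,\ (j+k)\bmod n=r\}$. A set $\mathcal E$ of $n$-cbc is compatible if $X_1\circ_{r_1}X_2\circ_{r_2}\cdots\circ_{r_k}X_{k+1}$ is an $n$-cbc for all $k\ge0$, $X_1,\dots,X_{k+1}\in\mathcal E$ and $r_1,\dots,r_k\in[n]$. It is of Hajós if there are $t_1,\dots,t_k>1$ ($k\ge 0$) such that, either for all $Y\in\mathcal E$ or for all duals $Y=\delta(Y')$ of elements $Y'\in\mathcal E$, there are cbc $Y_1,\dots,Y_{k-1}$ with $$Y\in H_{t_k}(Y_{k-1}),\ \delta(Y_{k-1})\in H_{t_{k-1}}(Y_{k-2}),\ \dots,\ \delta(Y_2)\in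 H_{t_2}(Y_1),\ \delta(Y_1)\in H_{t_1}(\{b\})$$ (for $k=1$ this reads $Y\in H_{t_1}(\{b\})$, and for $k=0$ it reads $Y=\{b\}$). A cbc Hajós number is an integer $n\ge1$ such that every compatible set of $n$-cbc is of Hajós. **Corollary.** Let $n$ be a cbc Hajós number, $\omega\in\mathcal A^*\setminus a^*$, and let $X\subseteq a^*\omega a^*$ be such that $\{a^n\}\cup X$ is a code. Then the following statements are equivalent: 1. $\{a^n\}\cup X$ is included in a finite maximal code; 2. $C_X(\omega)$ is included in an $n$-cbc; 3. $C_X(\omega)$ is included in a Hajós cbc of size $n$; 4. $\{a^n\}\cup X$ is a prefix-suffix code. -/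

import Mathlib

/-! Words over the alphabet `A` are lists, sets of words have type `Set (List A)`, and a code is a
set `C` with `InformationTheory.UniquelyDecodable C`: two lists of elements of `C` with the same
concatenation are equal. -/

namespace BayonetCode

variable {A : Type*}

/-! ### Finite maximal codes -/

/-- A finite code over `A` that is not properly contained in any code over `A`. -/
def IsFiniteMaximalCode (M : Set (List A)) : Prop :=
  M.Finite ∧ Maximal InformationTheory.UniquelyDecodable M

/-! ### Prefix-suffix codes -/

/-- A prefix code: a set of words other than `{ε}`, none of which is a prefix of another one. -/
def IsPrefixCode (D : Set (List A)) : Prop :=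
  D ≠ {[]} ∧ ∀ u ∈ D, ∀ v ∈ D, u <+: v → u = v

/-- A suffix code: a set of words other than `{ε}`, none of which is a suffix of another one. -/
def IsSuffixCode (D : Set (List A)) : Prop :=
  D ≠ {[]} ∧ ∀ u ∈ D, ∀ v ∈ D, u <:+ v → u = v

/-- `C'` is a prefix code over the code `C`: it is obtained from a prefix code `D` over the alphabet
whose letters are the elements of `C`, by reading each letter as the word over `A` that it is. -/
def IsPrefixCodeOver (C C' : Set (List A)) : Prop :=
  ∃ D : Set (List (List A)), (∀ d ∈ D, ∀ c ∈ d, c ∈ C) ∧ IsPrefixCode D ∧ C' = List.flatten '' D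

/-- `C'` is a suffix code over the code `C`. -/
def IsSuffixCodeOver (C C' : Set (List A)) : Prop :=
  ∃ D : Set (List (List A)), (∀ d ∈ D, ∀ c ∈ d, c ∈ C) ∧ IsSuffixCode D ∧ C' = List.flatten '' D

/-- The prefix-suffix codes over `B`: `B` itself, and every prefix or suffix code over a
prefix-suffix code over `B`. -/
inductive IsPrefixSuffixCodeOver (B : Set (List A)) : Set (List A) → Prop
  | base : IsPrefixSuffixCodeOver B B
  | prefixStep {C C' : Set (List A)} :
      IsPrefixSuffixCodeOver B C → IsPrefixCodeOver C C' → IsPrefixSuffixCodeOver B C'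
  | suffixStep {C C' : Set (List A)} :
      IsPrefixSuffixCodeOver B C → IsSuffixCodeOver C C' → IsPrefixSuffixCodeOver B C'

/-- A prefix-suffix code is a prefix-suffix code over the alphabet (the set of one-letter words). -/
def IsPrefixSuffixCode (C : Set (List A)) : Prop :=
  IsPrefixSuffixCodeOver (Set.range fun x : A => [x]) C

/-! ### Complete bayonet codes -/

/-- The word `a ^ k`. -/
def apow (a : A) (k : ℕ) : List A := List.replicate k a

/-- The word `a ^ i * w * a ^ j`. -/
def pad (a : A) (i : ℕ) (w : List A) (j : ℕ) : List A := apow a i ++ w ++ apow a j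

/-- The word `a ^ i * b * a ^ j`. -/
def bay (a b : A) (i j : ℕ) : List A := pad a i [b] j

/-- `M*`, the set of products of elements of `M`. -/
def star (M : Set (List A)) : Set (List A) :=
  {w | ∃ L : List (List A), (∀ v ∈ L, v ∈ M) ∧ w = L.flatten}

/-- `C_M(ω)`, the set of the words `a ^ (i mod n) * b * a ^ (j mod n)` such that
`a ^ i * ω * a ^ j` is in `M*`. -/
def cSet (a b : A) (n : ℕ) (M : Set (List A)) (ω : List A) : Set (List A) :=
  {w | ∃ i j : ℕ, pad a i ω j ∈ star M ∧ w = bay a b (i % n) (j % n)}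

/-- `X` is an `n`-complete bayonet code (`n`-cbc). -/
def IsCbc (a b : A) (n : ℕ) (X : Set (List A)) : Prop :=
  (∀ w ∈ X, ∃ i j : ℕ, i < n ∧ j < n ∧ w = bay a b i j) ∧
    X.ncard = n ∧ InformationTheory.UniquelyDecodable ({apow a n} ∪ X)

/-- The composition `X ∘_r Y` of `n`-cbc. -/
def comp (a b : A) (n r : ℕ) (X Y : Set (List A)) : Set (List A) :=
  {w | ∃ i j k l : ℕ, bay a b i j ∈ X ∧ bay a b k l ∈ Y ∧ (j + k) % n = r ∧ w = bay a b i l}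

/-- A set `E` of `n`-cbc is compatible: every composition `X₁ ∘_{r₁} X₂ ∘_{r₂} ⋯ ∘_{r_k} X_{k+1}`
(`k ≥ 0`) of elements of `E` with `r₁, …, r_k < n` is an `n`-cbc. The list `L` consists of the pairs
`(r₁, X₂), …, (r_k, X_{k+1})`. -/
def IsCompatible (a b : A) (n : ℕ) (E : Set (Set (List A))) : Prop :=
  ∀ X ∈ E, ∀ L : List (ℕ × Set (List A)), (∀ p ∈ L, p.1 < n ∧ p.2 ∈ E) →
    IsCbc a b n (L.foldl (fun Z p => comp a b n p.1 Z p.2) X)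

/-! ### Hajós codes -/

/-- The dual of a set of bayonet words. -/
def dual (a b : A) (X : Set (List A)) : Set (List A) :=
  {w | ∃ i j : ℕ, bay a b i j ∈ X ∧ w = bay a b j i}

/-- `Y ∈ H_t(X)`, for a set `X` of `m` words `a ^ i * b * a ^ j` with `i, j < m`: every such word of
`X` is replaced by the words `a ^ (i + k_s * m) * b * a ^ (j + s * m)` for `s = 0, …, t - 1`, where
`k_s < t` may depend on `s` and on the word of `X`. -/
def IsExpansion (a b : A) (m t : ℕ) (X Y : Set (List A)) : Prop :=
  ∃ k : ℕ → ℕ → ℕ → ℕ, (∀ i j s, k i j s < t) ∧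
    Y = {w | ∃ i j s : ℕ, bay a b i j ∈ X ∧ s < t ∧ w = bay a b (i + k i j s * m) (j + s * m)}

/-- The Hajós cbc of size `n` (the elements of `H_n`). -/
inductive IsHajosCbc (a b : A) : ℕ → Set (List A) → Prop
  | one : IsHajosCbc a b 1 {[b]}
  | right {m t : ℕ} {X Y : Set (List A)} : 1 < t → IsHajosCbc a b m X →
      IsExpansion a b m t X Y → IsHajosCbc a b (m * t) Y
  | left {m t : ℕ} {X Y : Set (List A)} : 1 < t → IsHajosCbc a b m X →
      IsExpansion a b m t X Y → IsHajosCbc a b (m * t) (dual a b Y)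

/-- `HajosChain a b [t_k, …, t_1] Y` says that there are cbc `Y_1, …, Y_{k-1}` with
`Y ∈ H_{t_k}(Y_{k-1})`, `dual Y_{k-1} ∈ H_{t_{k-1}}(Y_{k-2})`, …, `dual Y_1 ∈ H_{t_1}({b})`
(and, for `k = 0`, that `Y = {b}`). -/
def HajosChain (a b : A) : List ℕ → Set (List A) → Prop
  | [], Y => Y = {[b]}
  | t :: ts, Y => ∃ X : Set (List A), IsCbc a b ts.prod X ∧
      IsExpansion a b ts.prod t X Y ∧ HajosChain a b ts (dual a b X)

/-- A (compatible) set `E` of cbc is of Hajós: there are `t_1, …, t_k > 1` such that all the elements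
of `E`, or all their duals, have a chain as above with these parameters. -/
def IsHajosSet (a b : A) (E : Set (Set (List A))) : Prop :=
  ∃ ts : List ℕ, (∀ t ∈ ts, 1 < t) ∧
    ((∀ Y ∈ E, HajosChain a b ts Y) ∨ ∀ Y ∈ E, HajosChain a b ts (dual a b Y))

/-- `n ≥ 1` is a cbc Hajós number: every compatible set of `n`-cbc is of Hajós. -/
def IsCbcHajosNumber (a b : A) (n : ℕ) : Prop :=
  1 ≤ n ∧ ∀ E : Set (Set (List A)), IsCompatible a b n E → IsHajosSet a b E

end BayonetCode

namespace BayonetCode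

open InformationTheory Finset

variable {A : Type*}

/-! ### Products of codewords -/

/-! The proof runs around the cycle 1 → 2 → 3 → 4 → 1. Its engine is a count. For a finite code `M`
containing `a ^ n`, `rel a n M w` records modulo `n` the pairs `(i, j)` with `a ^ i * w * a ^ j` in
`M*`; these are the exponents of the words of `C_M(w)`. A long block of `a` between `w` and `w'`
must be cut by every factorization (`exists_cut`), so the set of `w * a ^ (K * n + r) * w'` is the
composition at `r` of those of `w` and `w'`. Since `M*` is stable (`star_stable`), these
compositions are unambiguous, and their sizes, summed over the `n` residues `r`, give the product of
the two sizes (`exists_sum_card_rel`). Comparing a word of largest size with itself bounds all sizes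
by `n`; comparing one of smallest size shows that all are `n` when none is empty.

1 → 2: a maximal code `M` is complete, so no residue set is empty, and `C_M(ω)` is an `n`-cbc
containing `C_X(ω)`.

2 → 3: a cbc `Y` is `C_M(b)` for `M = {a ^ n} ∪ Y`, and compositions of such sets are again of the
form `C_M(v)`, with `n` elements. So `{Y}` is compatible, and the Hajós hypothesis applies to it.

3 → 4: with `a ^ m` and the words `a ^ i * ω * a ^ j` as letters, a Hajós expansion is a suffix code
over these letters, and its dual is a prefix code. One more step of each kind replaces exponents
reduced modulo `n` by the actual ones.

4 → 1: each level of the tower of prefix and suffix codes is enlarged to a finite complete code. The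
count shows that a finite complete code containing `a ^ n` cannot be extended. -/

theorem nil_mem_star (M : Set (List A)) : [] ∈ star M := ⟨[], by simp, rfl⟩

theorem subset_star (M : Set (List A)) : M ⊆ star M := fun w hw => ⟨[w], by simpa, by simp⟩

theorem append_mem_star {M : Set (List A)} {u v : List A} (hu : u ∈ star M) (hv : v ∈ star M) :
    u ++ v ∈ star M := by
  obtain ⟨L, hL, rfl⟩ := hu
  obtain ⟨L', hL', rfl⟩ := hv
  refine ⟨L ++ L', ?_, by simp⟩
  intro v hv
  rcases List.mem_append.1 hv with h | h
  exacts [hL v h, hL' v h]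

theorem star_mono {M N : Set (List A)} (h : M ⊆ N) : star M ⊆ star N := by
  rintro _ ⟨L, hL, rfl⟩
  exact ⟨L, fun v hv => h (hL v hv), rfl⟩

theorem flatten_mem_star {M : Set (List A)} {L : List (List A)} (h : ∀ v ∈ L, v ∈ star M) :
    L.flatten ∈ star M := by
  induction L with
  | nil => exact nil_mem_star M
  | cons x L ih =>
    rw [List.flatten_cons]
    exact append_mem_star (h x (by simp)) (ih fun v hv => h v (by simp [hv]))

theorem uniquelyDecodable_mono {M N : Set (List A)} (h : M ⊆ N) (hN : UniquelyDecodable N) :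
    UniquelyDecodable M := fun L₁ L₂ h₁ h₂ =>
  hN L₁ L₂ (fun w hw => h (h₁ w hw)) fun w hw => h (h₂ w hw)

/-- The submonoid generated by a code is stable. -/
theorem star_stable {M : Set (List A)} (hM : UniquelyDecodable M) {u s v : List A}
    (hu : u ∈ star M) (hv : v ∈ star M) (hus : u ++ s ∈ star M) (hsv : s ++ v ∈ star M) :
    s ∈ star M := by
  obtain ⟨Lu, hLu, rfl⟩ := hu
  obtain ⟨Lv, hLv, rfl⟩ := hv
  obtain ⟨Lus, hLus, hus⟩ := hus
  obtain ⟨Lsv, hLsv, hsv⟩ := hsv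
  -- Both lists factor `u ++ s ++ v`. Once they agree, what `Lus` has beyond `Lu` factors `s`.
  have key : Lus ++ Lv = Lu ++ Lsv := by
    apply hM
    · intro w hw
      rcases List.mem_append.1 hw with h | h
      exacts [hLus w h, hLv w h]
    · intro w hw
      rcases List.mem_append.1 hw with h | h
      exacts [hLu w h, hLsv w h]
    · rw [List.flatten_append, List.flatten_append, ← hus, ← hsv, List.append_assoc]
  rcases List.append_eq_append_iff.1 key with ⟨T, hT, -⟩ | ⟨T, hT, -⟩
  · subst hT
    have : s = [] := by
      rw [List.flatten_append] at hus
      have := congrArg List.length hus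
      simp only [List.length_append] at this
      exact List.eq_nil_of_length_eq_zero (by omega)
    rw [this]
    exact nil_mem_star M
  · subst hT
    rw [List.flatten_append] at hus
    exact ⟨T, fun w hw => hLus w (by simp [hw]), List.append_cancel_left hus⟩

theorem exists_length_le {M : Set (List A)} (hM : M.Finite) :
    ∃ N : ℕ, ∀ v ∈ M, v.length ≤ N := by
  obtain ⟨N, hN⟩ := (hM.image List.length).bddAbove
  exact ⟨N, fun v hv => hN ⟨v, hv, rfl⟩⟩

/-- A factorization can be cut inside every long enough factor. -/
theorem exists_cut {M : Set (List A)} {N : ℕ} (hN : ∀ v ∈ M, v.length ≤ N) :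
    ∀ (L : List (List A)), (∀ v ∈ L, v ∈ M) → ∀ (p m s : List A), N ≤ m.length →
      L.flatten = p ++ m ++ s → ∃ m₁ m₂, m = m₁ ++ m₂ ∧ p ++ m₁ ∈ star M ∧ m₂ ++ s ∈ star M := by
  intro L
  induction L with
  | nil =>
    intro _ p m s _ h
    simp only [List.flatten_nil] at h
    have h1 := h.symm
    simp only [List.append_eq_nil_iff] at h1
    obtain ⟨⟨rfl, rfl⟩, rfl⟩ := h1
    exact ⟨[], [], by simp, nil_mem_star M, nil_mem_star M⟩
  | cons x L ih =>
    intro hL p m s hm h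
    have hx : x ∈ M := hL x (by simp)
    have hL' : ∀ v ∈ L, v ∈ M := fun v hv => hL v (by simp [hv])
    rw [List.flatten_cons, List.append_assoc] at h
    rcases List.append_eq_append_iff.1 h with ⟨c, hc, hc'⟩ | ⟨c, hc, hc'⟩
    · rw [← List.append_assoc] at hc'
      obtain ⟨m₁, m₂, h1, h2, h3⟩ := ih hL' c m s hm hc'
      refine ⟨m₁, m₂, h1, ?_, h3⟩
      rw [hc, List.append_assoc]
      exact append_mem_star (subset_star M hx) h2
    · rcases List.append_eq_append_iff.1 hc' with ⟨d, hd, hd'⟩ | ⟨d, hd, hd'⟩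
      · have h1 := hN x hx
        -- Here `x` covers all of `m`, which is at least as long as any codeword, so nothing of `x`
        -- extends beyond it.
        have h2 : d = [] := by
          rw [hc, hd] at h1
          simp only [List.length_append] at h1
          exact List.eq_nil_of_length_eq_zero (by omega)
        subst h2
        refine ⟨m, [], by simp, ?_, ?_⟩
        · have : x = p ++ m := by rw [hc, hd]; simp
          rw [← this]
          exact subset_star M hx
        · exact ⟨L, hL', by simpa using hd'⟩
      · exact ⟨c, d, hd, hc ▸ subset_star M hx, L, hL', hd'.symm⟩

/-! ### Powers of a letter -/

theorem apow_add (a : A) (i j : ℕ) : apow a (i + j) = apow a i ++ apow a j := by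
  simp [apow]

@[simp] theorem apow_zero (a : A) : apow a 0 = [] := rfl

@[simp] theorem length_apow (a : A) (i : ℕ) : (apow a i).length = i := by simp [apow]

theorem eq_apow_of_append_left {a : A} {k : ℕ} {u v : List A} (h : apow a k = u ++ v) :
    u = apow a u.length := by
  have := (List.eq_replicate_iff (l := u ++ v) (n := k) (a := a)).1 h.symm
  exact List.eq_replicate_iff.2 ⟨rfl, fun x hx => this.2 x (by simp [hx])⟩

theorem eq_apow_of_append_right {a : A} {k : ℕ} {u v : List A} (h : apow a k = u ++ v) :
    v = apow a v.length := by
  have := (List.eq_replicate_iff (l := u ++ v) (n := k) (a := a)).1 h.symm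
  exact List.eq_replicate_iff.2 ⟨rfl, fun x hx => this.2 x (by simp [hx])⟩

theorem apow_mul_mem_star {a : A} {n : ℕ} {M : Set (List A)} (h : apow a n ∈ M) (p : ℕ) :
    apow a (p * n) ∈ star M := by
  induction p with
  | zero => simpa using nil_mem_star M
  | succ p ih =>
    rw [Nat.succ_mul, apow_add]
    exact append_mem_star ih (subset_star M h)

theorem flatten_replicate_apow (a : A) (n k : ℕ) :
    (List.replicate k (apow a n)).flatten = apow a (k * n) := by
  induction k with
  | zero => simp
  | succ k ih => rw [List.replicate_succ, List.flatten_cons, ih, ← apow_add]; congr 1; ring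

/-- Repeating the factorization of `a ^ d` `n` times gives the same word as `d` copies of `a ^ n`,
so every factor must be `a ^ n`. -/
theorem dvd_of_apow_mem_star {a : A} {n : ℕ} (hn : 0 < n) {M : Set (List A)}
    (hM : UniquelyDecodable M) (h : apow a n ∈ M) {d : ℕ} (hd : apow a d ∈ star M) : n ∣ d := by
  obtain ⟨L, hL, hLd⟩ := hd
  have h1 : (List.replicate n L).flatten = List.replicate d (apow a n) := by
    apply hM
    · intro w hw
      obtain ⟨l, hl, hwl⟩ := List.mem_flatten.1 hw
      rw [List.eq_of_mem_replicate hl] at hwl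
      exact hL w hwl
    · intro w hw
      rw [List.eq_of_mem_replicate hw]
      exact h
    · rw [flatten_replicate_apow, List.flatten_flatten, List.map_replicate, ← hLd,
        flatten_replicate_apow, Nat.mul_comm]
  have h2 : ∀ w ∈ L, w = apow a n := by
    intro w hw
    have : w ∈ (List.replicate n L).flatten :=
      List.mem_flatten.2 ⟨L, by simp [hn.ne'], hw⟩
    rw [h1] at this
    exact List.eq_of_mem_replicate this
  rw [List.eq_replicate_of_mem h2, flatten_replicate_apow] at hLd
  have := congrArg List.length hLd
  simp only [length_apow] at this
  exact ⟨L.length, by rw [this, Nat.mul_comm]⟩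

theorem pad_add_left (a : A) (p i : ℕ) (w : List A) (j : ℕ) :
    pad a (p + i) w j = apow a p ++ pad a i w j := by simp [pad, apow_add]

theorem pad_add_right (a : A) (i : ℕ) (w : List A) (j q : ℕ) :
    pad a i w (j + q) = pad a i w j ++ apow a q := by simp [pad, apow_add]

theorem pad_append_pad (a : A) (i : ℕ) (w : List A) (j k : ℕ) (w' : List A) (l : ℕ) :
    pad a i w j ++ pad a k w' l = pad a i (w ++ apow a (j + k) ++ w') l := by
  simp [pad, apow_add]

theorem pad_mem_star_add {a : A} {n : ℕ} {M : Set (List A)} (h : apow a n ∈ M) {i j : ℕ}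
    {w : List A} (hw : pad a i w j ∈ star M) (p q : ℕ) :
    pad a (i + p * n) w (j + q * n) ∈ star M := by
  rw [Nat.add_comm i, pad_add_left, pad_add_right]
  exact append_mem_star (apow_mul_mem_star h p) (append_mem_star hw (apow_mul_mem_star h q))

theorem pad_mem_star_of_modEq {a : A} {n : ℕ} {M : Set (List A)} (h : apow a n ∈ M) {i j i' j' : ℕ}
    {w : List A} (hw : pad a i w j ∈ star M) (hi : i ≡ i' [MOD n]) (hj : j ≡ j' [MOD n])
    (hii : i ≤ i') (hjj : j ≤ j') : pad a i' w j' ∈ star M := by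
  obtain ⟨p, hp⟩ := (Nat.modEq_iff_dvd' hii).1 hi
  obtain ⟨q, hq⟩ := (Nat.modEq_iff_dvd' hjj).1 hj
  have e1 : i' = i + p * n := by rw [Nat.mul_comm]; omega
  have e2 : j' = j + q * n := by rw [Nat.mul_comm]; omega
  rw [e1, e2]
  exact pad_mem_star_add h hw p q

/-! ### The residues of the paddings of a word -/

open Classical in
/-- The pairs of residues modulo `n` of the `(i, j)` such that `a ^ i * w * a ^ j` is in `M*`. -/
noncomputable def rel (a : A) (n : ℕ) (M : Set (List A)) (w : List A) : Finset (ℕ × ℕ) :=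
  {x ∈ range n ×ˢ range n |
    ∃ i j, pad a i w j ∈ star M ∧ i ≡ x.1 [MOD n] ∧ j ≡ x.2 [MOD n]}

theorem mem_rel {a : A} {n : ℕ} {M : Set (List A)} {w : List A} {x : ℕ × ℕ} :
    x ∈ rel a n M w ↔ x.1 < n ∧ x.2 < n ∧
      ∃ i j, pad a i w j ∈ star M ∧ i ≡ x.1 [MOD n] ∧ j ≡ x.2 [MOD n] := by
  simp [rel, and_assoc]

/-- Exponents may be raised by multiples of `n` because `a ^ n` is a codeword, and only finitely
many residue pairs compete for the threshold. -/
theorem exists_uniform_pad {a : A} {n : ℕ} {M : Set (List A)} (h : apow a n ∈ M)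
    (w : List A) : ∃ q, ∀ p ≥ q, ∀ x ∈ rel a n M w, ∀ i j, i ≡ x.1 [MOD n] → j ≡ x.2 [MOD n] →
      p ≤ i → p ≤ j → pad a i w j ∈ star M := by
  have h1 : ∀ x ∈ rel a n M w, ∃ q, ∀ i j, i ≡ x.1 [MOD n] → j ≡ x.2 [MOD n] →
      q ≤ i → q ≤ j → pad a i w j ∈ star M := by
    intro x hx
    obtain ⟨-, -, i, j, hij, hi, hj⟩ := mem_rel.1 hx
    refine ⟨i + j, fun i' j' hi' hj' hi'' hj'' => ?_⟩
    exact pad_mem_star_of_modEq h hij (hi.trans hi'.symm) (hj.trans hj'.symm)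
      (by omega) (by omega)
  choose! q hq using h1
  refine ⟨(rel a n M w).sup q, fun p hp x hx i j hi hj hpi hpj => ?_⟩
  have := Finset.le_sup (f := q) hx
  exact hq x hx i j hi hj (by omega) (by omega)

/-- Compositions are unambiguous. -/
theorem rel_unambiguous {a : A} {n : ℕ} (hn : 0 < n) {M : Set (List A)}
    (hM : UniquelyDecodable M) (h : apow a n ∈ M) {w w' : List A} {i j j' k k' l : ℕ}
    (h1 : (i, j) ∈ rel a n M w) (h2 : (i, j') ∈ rel a n M w) (h3 : (k, l) ∈ rel a n M w')
    (h4 : (k', l) ∈ rel a n M w') (hr : j + k ≡ j' + k' [MOD n]) : j = j' ∧ k = k' := by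
  wlog hjj : j ≤ j' generalizing j j' k k'
  · have := this h2 h1 h4 h3 hr.symm (by omega)
    exact ⟨this.1.symm, this.2.symm⟩
  obtain ⟨q, hq⟩ := exists_uniform_pad h w
  obtain ⟨q', hq'⟩ := exists_uniform_pad h w'
  obtain ⟨hi, hj, -⟩ := mem_rel.1 h1
  obtain ⟨-, hj', -⟩ := mem_rel.1 h2
  obtain ⟨hk, hl, -⟩ := mem_rel.1 h3
  obtain ⟨hk', -, -⟩ := mem_rel.1 h4
  simp only at hi hj hj' hk hk' hl
  have hmod : ∀ x y : ℕ, x + y * n ≡ x [MOD n] := fun x y => by simp [Nat.ModEq]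
  have hle : ∀ y : ℕ, y ≤ y * n := fun y => Nat.le_mul_of_pos_right y hn
  have a1 := hq q le_rfl _ h1 (i + q * n) (j + q * n) (hmod _ _) (hmod _ _)
    (by have := hle q; omega) (by have := hle q; omega)
  have a2 := hq q le_rfl _ h2 (i + q * n) (j + q * n + (j' - j)) (hmod _ _)
    (by
      have : j + q * n + (j' - j) = j' + q * n := by omega
      rw [this]
      exact hmod _ _)
    (by have := hle q; omega) (by have := hle q; omega)
  have a4 := hq' q' le_rfl _ h4 (k' + q' * n) (l + q' * n) (hmod _ _) (hmod _ _)
    (by have := hle q'; omega) (by have := hle q'; omega)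
  have a3 := hq' q' le_rfl _ h3 ((j' - j) + (k' + q' * n)) (l + q' * n)
    (by
      have : j + ((j' - j) + (k' + q' * n)) ≡ j + k [MOD n] := by
        have e : j + ((j' - j) + (k' + q' * n)) = (j' + k') + q' * n := by omega
        rw [e]
        exact (hmod _ _).trans hr.symm
      exact Nat.ModEq.add_left_cancel' j this)
    (hmod _ _)
    (by have := hle q'; omega) (by have := hle q'; omega)
  rw [pad_add_right] at a2
  rw [pad_add_left] at a3
  -- Stability with `s = a ^ (j' - j)`: it can be appended to a padding of `w`, or prepended to one
  -- of `w'`, without leaving `M*`. Hence `n` divides `j' - j`, which is less than `n`.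
  have hd := dvd_of_apow_mem_star hn hM h (star_stable hM a1 a4 a2 a3)
  have e : j' - j = 0 := Nat.eq_zero_of_dvd_of_lt hd (by omega)
  have e' : j = j' := by omega
  subst e'
  refine ⟨rfl, ?_⟩
  have := Nat.ModEq.add_left_cancel' j hr
  exact Nat.ModEq.eq_of_lt_of_lt this hk hk'

/-- Composition of residue pairs. -/
theorem exists_rel_comp {a : A} {n : ℕ} (hn : 0 < n) {M : Set (List A)} (hfin : M.Finite)
    (h : apow a n ∈ M) (w w' : List A) : ∃ K, ∀ r < n, ∀ i l,
      (i, l) ∈ rel a n M (w ++ apow a (K * n + r) ++ w') ↔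
        ∃ j k, (i, j) ∈ rel a n M w ∧ (k, l) ∈ rel a n M w' ∧ (j + k) % n = r := by
  obtain ⟨N, hN⟩ := exists_length_le hfin
  obtain ⟨q, hq⟩ := exists_uniform_pad h w
  obtain ⟨q', hq'⟩ := exists_uniform_pad h w'
  have hmod : ∀ x y : ℕ, x + y * n ≡ x [MOD n] := fun x y => by simp [Nat.ModEq]
  have hle : ∀ y : ℕ, y ≤ y * n := fun y => Nat.le_mul_of_pos_right y hn
  -- The block has length at least `N`, so it is cut by any factorization, and it has room for
  -- exponents above both thresholds `q` and `q'`.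
  refine ⟨N + (q + q' + 2), fun r hr i l => ⟨fun hx => ?_, ?_⟩⟩
  · obtain ⟨hi, hl, i', l', hil, hi', hl'⟩ := mem_rel.1 hx
    obtain ⟨L, hL, hLw⟩ := hil
    obtain ⟨m₁, m₂, e1, e2, e3⟩ := exists_cut hN L hL (apow a i' ++ w)
      (apow a ((N + (q + q' + 2)) * n + r)) (w' ++ apow a l')
      (by
        have := hle (N + (q + q' + 2))
        rw [length_apow]
        omega)
      (by rw [← hLw]; simp [pad])
    have e4 := eq_apow_of_append_left e1
    have e5 := eq_apow_of_append_right e1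
    have e6 := congrArg List.length e1
    rw [length_apow, List.length_append] at e6
    refine ⟨m₁.length % n, m₂.length % n, mem_rel.2 ⟨hi, Nat.mod_lt _ hn, i', m₁.length, ?_, hi', ?_⟩,
      mem_rel.2 ⟨Nat.mod_lt _ hn, hl, m₂.length, l', ?_, ?_, hl'⟩, ?_⟩
    · rw [pad, ← e4]; exact e2
    · exact (Nat.mod_modEq _ _).symm
    · rw [pad, ← e5, List.append_assoc]; exact e3
    · exact (Nat.mod_modEq _ _).symm
    · rw [← Nat.add_mod, ← e6, Nat.add_comm, Nat.add_mul_mod_self_right, Nat.mod_eq_of_lt hr]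
  · rintro ⟨j, k, h1, h2, hjk⟩
    obtain ⟨hi, hj, -⟩ := mem_rel.1 h1
    obtain ⟨hk, hl, -⟩ := mem_rel.1 h2
    simp only at hi hj hk hl
    set K := N + (q + q' + 2) with hK
    have b1 := hle q
    have b2 := hle q'
    have b4 : K * n = N * n + q * n + q' * n + 2 * n := by rw [hK]; ring
    have c := hq q le_rfl _ h1 (i + q * n) (j + q * n) (hmod _ _) (hmod _ _)
      (by omega) (by omega)
    have c' := hq' q' le_rfl _ h2 (K * n + r - (j + q * n)) (l + q' * n)
      (by
        have : (j + q * n) + (K * n + r - (j + q * n)) ≡ (j + q * n) + k [MOD n] := by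
          have e : (j + q * n) + (K * n + r - (j + q * n)) = r + K * n := by omega
          have e' : (j + q * n) + k = (j + k) + q * n := by omega
          rw [e, e']
          refine (hmod _ _).trans (Nat.ModEq.trans ?_ (hmod _ _).symm)
          rw [← hjk]
          exact Nat.mod_modEq _ _
        exact Nat.ModEq.add_left_cancel' _ this)
      (hmod _ _) (by omega) (by omega)
    have c2 := append_mem_star c c'
    rw [pad_append_pad] at c2
    have e : j + q * n + (K * n + r - (j + q * n)) = K * n + r := by omega
    rw [e] at c2
    exact mem_rel.2 ⟨hi, hl, _, _, c2, hmod _ _, hmod _ _⟩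

/-- The product of the two residue sets is split according to `(j + k) % n`; by unambiguity each
fibre is in bijection with one composition. -/
theorem exists_sum_card_rel {a : A} {n : ℕ} (hn : 0 < n) {M : Set (List A)} (hfin : M.Finite)
    (hM : UniquelyDecodable M) (h : apow a n ∈ M) (w w' : List A) : ∃ K,
      (∀ r < n, ∀ i l, (i, l) ∈ rel a n M (w ++ apow a (K * n + r) ++ w') ↔
        ∃ j k, (i, j) ∈ rel a n M w ∧ (k, l) ∈ rel a n M w' ∧ (j + k) % n = r) ∧
      ∑ r ∈ range n, #(rel a n M (w ++ apow a (K * n + r) ++ w')) =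
        #(rel a n M w) * #(rel a n M w') := by
  obtain ⟨K, hK⟩ := exists_rel_comp hn hfin h w w'
  refine ⟨K, hK, ?_⟩
  rw [← card_product, card_eq_sum_card_fiberwise (t := range n)
    (f := fun x : (ℕ × ℕ) × (ℕ × ℕ) => (x.1.2 + x.2.1) % n)
    (fun x _ => by simpa using Nat.mod_lt _ hn)]
  refine sum_congr rfl fun r hr => Eq.symm ?_
  refine card_bij (fun x _ => (x.1.1, x.2.2)) ?_ ?_ ?_
  · rintro ⟨⟨i, j⟩, k, l⟩ hx
    simp only [mem_filter, mem_product] at hx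
    exact (hK r (mem_range.1 hr) i l).2 ⟨j, k, hx.1.1, hx.1.2, hx.2⟩
  · rintro ⟨⟨i, j⟩, k, l⟩ hx ⟨⟨i', j'⟩, k', l'⟩ hx' he
    simp only [mem_filter, mem_product, Prod.mk.injEq] at hx hx' he
    obtain ⟨rfl, rfl⟩ := he
    obtain ⟨rfl, rfl⟩ := rel_unambiguous hn hM h hx.1.1 hx'.1.1 hx.1.2 hx'.1.2
      (hx.2.trans hx'.2.symm)
    rfl
  · rintro ⟨i, l⟩ hx
    obtain ⟨j, k, h1, h2, h3⟩ := (hK r (mem_range.1 hr) i l).1 hx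
    exact ⟨((i, j), k, l), by simp [h1, h2, h3], rfl⟩

/-- If `c` is the largest size, composing a word of size `c` with itself gives `c * c ≤ n * c`. -/
theorem card_rel_le {a : A} {n : ℕ} (hn : 0 < n) {M : Set (List A)} (hfin : M.Finite)
    (hM : UniquelyDecodable M) (h : apow a n ∈ M) (w : List A) : #(rel a n M w) ≤ n := by
  have hb : ∀ w, #(rel a n M w) ≤ n * n := fun w => by
    classical
    refine (card_le_card (t := range n ×ˢ range n) fun x hx => ?_).trans (by simp)
    obtain ⟨h1, h2, -⟩ := mem_rel.1 hx
    simp [h1, h2]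
  obtain ⟨c, ⟨w₀, hw₀⟩, hc⟩ : ∃ c, (∃ w, #(rel a n M w) = c) ∧ ∀ w, #(rel a n M w) ≤ c := by
    have hbdd : BddAbove (Set.range fun w => #(rel a n M w)) :=
      ⟨n * n, by rintro _ ⟨w, rfl⟩; exact hb w⟩
    exact ⟨_, Nat.sSup_mem (Set.range_nonempty _) hbdd, fun w => le_csSup hbdd ⟨w, rfl⟩⟩
  obtain ⟨K, -, hK⟩ := exists_sum_card_rel hn hfin hM h w₀ w₀
  rw [hw₀] at hK
  have := sum_le_card_nsmul (range n) _ c fun r _ => hc (w₀ ++ apow a (K * n + r) ++ w₀)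
  rw [hK, card_range, smul_eq_mul] at this
  refine (hc w).trans ?_
  by_contra hlt
  have hc0 : 0 < c := by omega
  exact hlt (Nat.le_of_mul_le_mul_right this hc0)

/-- The same count with the smallest size `c` gives `n * c ≤ c * c`; nonemptiness is what allows `c`
to be cancelled. -/
theorem card_rel_eq {a : A} {n : ℕ} (hn : 0 < n) {M : Set (List A)} (hfin : M.Finite)
    (hM : UniquelyDecodable M) (h : apow a n ∈ M) (hne : ∀ w, (rel a n M w).Nonempty)
    (w : List A) : #(rel a n M w) = n := by
  refine le_antisymm (card_rel_le hn hfin hM h w) ?_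
  obtain ⟨c, ⟨w₀, hw₀⟩, hc⟩ : ∃ c, (∃ w, #(rel a n M w) = c) ∧ ∀ w, c ≤ #(rel a n M w) :=
    ⟨_, Nat.sInf_mem (Set.range_nonempty fun w => #(rel a n M w)), fun w => Nat.sInf_le ⟨w, rfl⟩⟩
  obtain ⟨K, -, hK⟩ := exists_sum_card_rel hn hfin hM h w₀ w₀
  rw [hw₀] at hK
  have := card_nsmul_le_sum (range n) _ c fun r _ => hc (w₀ ++ apow a (K * n + r) ++ w₀)
  rw [hK, card_range, smul_eq_mul] at this
  have hc0 : 0 < c := by rw [← hw₀]; exact (hne w₀).card_pos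
  exact (Nat.le_of_mul_le_mul_right this hc0).trans (hc w)

/-- If two residue sets have `n` elements, then so have their compositions. -/
theorem exists_comp_card_eq {a : A} {n : ℕ} (hn : 0 < n) {M : Set (List A)} (hfin : M.Finite)
    (hM : UniquelyDecodable M) (h : apow a n ∈ M) {w w' : List A} (hw : #(rel a n M w) = n)
    (hw' : #(rel a n M w') = n) {r : ℕ} (hr : r < n) : ∃ v, #(rel a n M v) = n ∧
      ∀ i l, (i, l) ∈ rel a n M v ↔
        ∃ j k, (i, j) ∈ rel a n M w ∧ (k, l) ∈ rel a n M w' ∧ (j + k) % n = r := by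
  obtain ⟨K, hK, hs⟩ := exists_sum_card_rel hn hfin hM h w w'
  refine ⟨_, ?_, hK r hr⟩
  rw [hw, hw'] at hs
  -- There are `n` sizes, each at most `n`, with sum `n * n`, so all are equal to `n`.
  have := (sum_eq_sum_iff_of_le (s := range n) (g := fun _ => n)
    fun r _ => card_rel_le hn hfin hM h (w ++ apow a (K * n + r) ++ w')).1 (by rw [hs]; simp)
  exact this r (mem_range.2 hr)

/-! ### Bayonet words -/

/-- Commuting with `a ^ d` implies commuting with its powers, so `w` is a prefix of a power of `a`
at least as long as itself. -/
theorem eq_apow_of_commute {a : A} {d : ℕ} (hd : 0 < d) {w : List A}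
    (h : w ++ apow a d = apow a d ++ w) : w = apow a w.length := by
  have h1 : ∀ k, w ++ apow a (k * d) = apow a (k * d) ++ w := by
    intro k
    induction k with
    | zero => simp
    | succ k ih =>
      rw [Nat.succ_mul, apow_add, ← List.append_assoc, ih, List.append_assoc, h,
        List.append_assoc]
  have h2 : w <+: apow a (w.length * d) := by
    refine List.prefix_of_prefix_length_le (l₃ := w ++ apow a (w.length * d))
      (List.prefix_append _ _) ?_ ?_
    · rw [h1]
      exact List.prefix_append _ _
    · rw [length_apow]
      exact Nat.le_mul_of_pos_right _ hd
  obtain ⟨t, ht⟩ := h2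
  exact eq_apow_of_append_left ht.symm

/-- If the left exponents differ by `d > 0`, cancellation leaves a word commuting with `a ^ d`,
hence a power of `a`. -/
theorem pad_inj {a : A} {w : List A} (hw : ∀ k, w ≠ apow a k) {i j i' j' : ℕ}
    (h : pad a i w j = pad a i' w j') : i = i' ∧ j = j' := by
  wlog hii : i ≤ i' generalizing i j i' j'
  · have := this h.symm (by omega)
    exact ⟨this.1.symm, this.2.symm⟩
  obtain ⟨d, rfl⟩ := Nat.exists_eq_add_of_le hii
  have hl := congrArg List.length h
  simp only [pad, List.length_append, length_apow] at hl
  have hj : j = d + j' := by omega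
  subst hj
  rw [pad, pad, apow_add, apow_add] at h
  simp only [List.append_assoc] at h
  have h1 := List.append_cancel_left h
  simp only [← List.append_assoc] at h1
  have h2 := List.append_cancel_right h1
  rcases Nat.eq_zero_or_pos d with rfl | hd
  · simp
  · exact absurd (eq_apow_of_commute hd h2) (hw _)

theorem singleton_ne_apow {a b : A} (hab : a ≠ b) (k : ℕ) : [b] ≠ apow a k := by
  intro h
  have : b ∈ apow a k := h ▸ List.mem_singleton_self b
  exact hab (List.eq_of_mem_replicate this).symm

theorem bay_inj {a b : A} (hab : a ≠ b) {i j i' j' : ℕ} (h : bay a b i j = bay a b i' j') :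
    i = i' ∧ j = j' :=
  pad_inj (singleton_ne_apow hab) h

theorem bay_injective {a b : A} (hab : a ≠ b) :
    Function.Injective fun x : ℕ × ℕ => bay a b x.1 x.2 := fun _ _ h =>
  Prod.ext (bay_inj hab h).1 (bay_inj hab h).2

theorem bay_eq (a b : A) (i j : ℕ) : bay a b i j = apow a i ++ b :: apow a j := by
  simp [bay, pad]

theorem apow_succ (a : A) (k : ℕ) : apow a (k + 1) = a :: apow a k := rfl

theorem apow_append_cons_inj {a b b' : A} (hab : a ≠ b) (hab' : a ≠ b') {u v : List A} :
    ∀ {i i' : ℕ}, apow a i ++ b :: u = apow a i' ++ b' :: v → i = i' ∧ b = b' ∧ u = v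
  | 0, 0, h => by simpa using h
  | 0, i' + 1, h => by
    rw [apow_succ, apow_zero, List.nil_append, List.cons_append, List.cons.injEq] at h
    exact absurd h.1.symm hab
  | i + 1, 0, h => by
    rw [apow_succ, apow_zero, List.nil_append, List.cons_append, List.cons.injEq] at h
    exact absurd h.1 hab'
  | i + 1, i' + 1, h => by
    rw [apow_succ, apow_succ, List.cons_append, List.cons_append, List.cons.injEq] at h
    obtain ⟨rfl, h'⟩ := apow_append_cons_inj hab hab' h.2
    exact ⟨rfl, h'⟩

theorem cSet_eq_image (a b : A) {n : ℕ} (hn : 0 < n) (M : Set (List A)) (w : List A) :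
    cSet a b n M w = (fun x : ℕ × ℕ => bay a b x.1 x.2) '' (rel a n M w : Set (ℕ × ℕ)) := by
  ext v
  constructor
  · rintro ⟨i, j, hij, rfl⟩
    exact ⟨(i % n, j % n), mem_coe.2 (mem_rel.2 ⟨Nat.mod_lt _ hn, Nat.mod_lt _ hn, i, j, hij,
      (Nat.mod_modEq _ _).symm, (Nat.mod_modEq _ _).symm⟩), rfl⟩
  · rintro ⟨⟨i, j⟩, hx, rfl⟩
    obtain ⟨hi, hj, i', j', hij, hi', hj'⟩ := mem_rel.1 (mem_coe.1 hx)
    refine ⟨i', j', hij, ?_⟩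
    simp only at hi hj hi' hj' ⊢
    rw [Nat.ModEq, Nat.mod_eq_of_lt hi] at hi'
    rw [Nat.ModEq, Nat.mod_eq_of_lt hj] at hj'
    rw [hi', hj']

theorem bay_mem_cSet {a b : A} (hab : a ≠ b) {n : ℕ} (hn : 0 < n) {M : Set (List A)} {w : List A}
    {i j : ℕ} : bay a b i j ∈ cSet a b n M w ↔ (i, j) ∈ rel a n M w := by
  rw [cSet_eq_image a b hn]
  exact (bay_injective hab).mem_set_image (a := (i, j))

theorem ncard_cSet {a b : A} (hab : a ≠ b) {n : ℕ} (hn : 0 < n) (M : Set (List A)) (w : List A) :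
    (cSet a b n M w).ncard = #(rel a n M w) := by
  rw [cSet_eq_image a b hn, Set.ncard_image_of_injective _ (bay_injective hab),
    Set.ncard_coe_finset]

theorem finite_cSet (a b : A) {n : ℕ} (hn : 0 < n) (M : Set (List A)) (w : List A) :
    (cSet a b n M w).Finite := by
  rw [cSet_eq_image a b hn]
  exact (finite_toSet _).image _

/-! ### The sets `C_M(ω)` are codes -/

open Classical in
/-- The morphism sending `b` to `v` and fixing the other letters. -/
noncomputable def substLetter (b : A) (v : List A) (u : List A) : List A :=
  u.flatMap fun x => if x = b then v else [x]

theorem substLetter_append (b : A) (v u u' : List A) :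
    substLetter b v (u ++ u') = substLetter b v u ++ substLetter b v u' := by
  simp [substLetter]

theorem substLetter_flatten (b : A) (v : List A) (L : List (List A)) :
    substLetter b v L.flatten = (L.map (substLetter b v)).flatten := by
  induction L with
  | nil => simp [substLetter]
  | cons x L ih => rw [List.flatten_cons, substLetter_append, ih]; simp

theorem substLetter_apow {a b : A} (hab : a ≠ b) (v : List A) (k : ℕ) :
    substLetter b v (apow a k) = apow a k := by
  induction k with
  | zero => simp [substLetter]
  | succ k ih =>
    have : apow a (k + 1) = [a] ++ apow a k := rfl
    rw [this, substLetter_append, ih]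
    simp [substLetter, hab]

theorem substLetter_bay {a b : A} (hab : a ≠ b) (w : List A) (K i j : ℕ) :
    substLetter b (pad a K w K) (bay a b i j) = pad a (i + K) w (K + j) := by
  have : bay a b i j = apow a i ++ ([b] ++ apow a j) := by simp [bay, pad]
  rw [this, substLetter_append, substLetter_append, substLetter_apow hab, substLetter_apow hab,
    pad_add_left, pad_add_right]
  simp [substLetter]

/-- Substituting a sufficiently padded `w` for `b` maps products of these words into `M*`. Two equal
products are compared from the left: if their first words are bayonets, these share the left
exponent `i`, and stability of `M*` puts the power of `a` by which the right exponents differ into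
`M*`. Its exponent is below `n` and divisible by `n`, so it vanishes. -/
theorem uniquelyDecodable_cSet {a b : A} (hab : a ≠ b) {n : ℕ} (hn : 0 < n) {M : Set (List A)}
    (hM : UniquelyDecodable M) (h : apow a n ∈ M) (w : List A) :
    UniquelyDecodable ({apow a n} ∪ cSet a b n M w) := by
  obtain ⟨q, hq⟩ := exists_uniform_pad h w
  have hmod : ∀ x y : ℕ, x + y * n ≡ x [MOD n] := fun x y => by simp [Nat.ModEq]
  have hmod' : ∀ x y : ℕ, y * n + x ≡ x [MOD n] := fun x y => by simp [Nat.ModEq]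
  have hqn : q ≤ q * n := Nat.le_mul_of_pos_right q hn
  -- A multiple of `n` preserves residues, and this one is beyond the threshold `q`.
  set K := q * n with hK
  set φ : List A → List A := substLetter b (pad a K w K) with hφ
  have hpad : ∀ {i j : ℕ}, bay a b i j ∈ cSet a b n M w → pad a (i + K) w (K + j) ∈ star M := by
    intro i j hij
    exact hq q le_rfl _ ((bay_mem_cSet hab hn).1 hij) _ _ (hmod _ _) (hmod' _ _)
      (by omega) (by omega)
  have hform : ∀ x ∈ {apow a n} ∪ cSet a b n M w,
      x = apow a n ∨ ∃ i j, i < n ∧ j < n ∧ x = bay a b i j ∧ bay a b i j ∈ cSet a b n M w := by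
    rintro x (hx | hx)
    · exact Or.inl hx
    · obtain ⟨i, j, hij, rfl⟩ := id hx
      exact Or.inr ⟨_, _, Nat.mod_lt _ hn, Nat.mod_lt _ hn, rfl, hx⟩
  have hstar : ∀ L : List (List A), (∀ x ∈ L, x ∈ {apow a n} ∪ cSet a b n M w) →
      φ L.flatten ∈ star M := by
    intro L hL
    rw [hφ, substLetter_flatten]
    apply flatten_mem_star
    intro v hv
    obtain ⟨x, hx, rfl⟩ := List.mem_map.1 hv
    rcases hform x (hL x hx) with rfl | ⟨i, j, -, -, rfl, hij⟩
    · rw [substLetter_apow hab]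
      exact subset_star M h
    · rw [substLetter_bay hab]
      exact hpad hij
  have hcancel : ∀ {i j j' : ℕ} {f f' : List A}, bay a b i j ∈ cSet a b n M w →
      bay a b i j' ∈ cSet a b n M w → j' < n → φ f ∈ star M → φ f' ∈ star M → j ≤ j' →
      apow a j ++ f = apow a j' ++ f' → j = j' := by
    intro i j j' f f' h1 h2 hj' hf hf' hjj he
    obtain ⟨d, rfl⟩ := Nat.exists_eq_add_of_le hjj
    rw [apow_add, List.append_assoc] at he
    have he' := List.append_cancel_left he
    have h3 := hpad h2
    rw [← Nat.add_assoc, pad_add_right] at h3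
    rw [he', hφ, substLetter_append, substLetter_apow hab] at hf
    have := dvd_of_apow_mem_star hn hM h (star_stable hM (hpad h1) hf' h3 hf)
    have := Nat.eq_zero_of_dvd_of_lt this (by omega)
    omega
  have hne : ∀ x ∈ {apow a n} ∪ cSet a b n M w, x ≠ [] := by
    intro x hx hx0
    rcases hform x hx with rfl | ⟨i, j, -, -, rfl, -⟩
    · have := congrArg List.length hx0
      simp at this
      omega
    · simp [bay, pad] at hx0
  have hmix : ∀ {i j : ℕ} {f f' : List A}, i < n → apow a n ++ f = bay a b i j ++ f' → False := by
    intro i j f f' hi he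
    obtain ⟨d, rfl⟩ := Nat.exists_eq_add_of_lt hi
    rw [bay_eq, Nat.add_assoc, apow_add, apow_succ] at he
    simp only [List.append_assoc, List.cons_append] at he
    have := List.append_cancel_left he
    simp only [List.cons.injEq] at this
    exact hab this.1
  intro L₁
  induction L₁ with
  | nil =>
    intro L₂ _ h2 he
    cases L₂ with
    | nil => rfl
    | cons x L =>
      have : x = [] := by
        have := he.symm
        simp only [List.flatten_cons, List.flatten_nil, List.append_eq_nil_iff] at this
        exact this.1
      exact absurd this (hne x (h2 x (by simp)))
  | cons x L₁ ih =>
    intro L₂ h1 h2 he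
    cases L₂ with
    | nil =>
      have : x = [] := by
        simp only [List.flatten_cons, List.flatten_nil, List.append_eq_nil_iff] at he
        exact he.1
      exact absurd this (hne x (h1 x (by simp)))
    | cons y L₂ =>
      have h1' : ∀ v ∈ L₁, v ∈ {apow a n} ∪ cSet a b n M w := fun v hv => h1 v (by simp [hv])
      have h2' : ∀ v ∈ L₂, v ∈ {apow a n} ∪ cSet a b n M w := fun v hv => h2 v (by simp [hv])
      rw [List.flatten_cons, List.flatten_cons] at he
      have hxy : x = y := by
        rcases hform x (h1 x (by simp)) with rfl | ⟨i, j, hi, hj, rfl, hij⟩ <;>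
          rcases hform y (h2 y (by simp)) with rfl | ⟨i', j', hi', hj', rfl, hij'⟩
        · rfl
        · exact (hmix hi' he).elim
        · exact (hmix hi he.symm).elim
        · rw [bay_eq, bay_eq] at he
          simp only [List.append_assoc, List.cons_append] at he
          obtain ⟨rfl, -, he'⟩ := apow_append_cons_inj hab hab he
          rcases le_total j j' with hjj | hjj
          · rw [hcancel hij hij' hj' (hstar _ h1') (hstar _ h2') hjj he']
          · rw [hcancel hij' hij hj (hstar _ h2') (hstar _ h1') hjj he'.symm]
      subst hxy
      rw [ih L₂ h1' h2' (List.append_cancel_left he)]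

theorem isCbc_cSet {a b : A} (hab : a ≠ b) {n : ℕ} (hn : 0 < n) {M : Set (List A)}
    (hM : UniquelyDecodable M) (h : apow a n ∈ M) {w : List A} (hw : #(rel a n M w) = n) :
    IsCbc a b n (cSet a b n M w) := by
  refine ⟨?_, by rw [ncard_cSet hab hn, hw], uniquelyDecodable_cSet hab hn hM h w⟩
  rintro _ ⟨i, j, -, rfl⟩
  exact ⟨_, _, Nat.mod_lt _ hn, Nat.mod_lt _ hn, rfl⟩

/-! ### Completeness and maximality -/

/-- Every word is a factor of a product of elements of `M`. -/
def IsComplete (M : Set (List A)) : Prop := ∀ w, ∃ u v, u ++ w ++ v ∈ star M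

/-- Surround `w` by two blocks `a ^ N` longer than or equal to any codeword and complete the result
to a product. Cutting inside both blocks isolates a padding of `w` in `M*`. -/
theorem IsComplete.rel_nonempty {M : Set (List A)} (hc : IsComplete M) {a : A} {n : ℕ}
    (hn : 0 < n) (hfin : M.Finite) (w : List A) : (rel a n M w).Nonempty := by
  obtain ⟨N, hN⟩ := exists_length_le hfin
  obtain ⟨u, v, L, hL, hLw⟩ := hc (apow a N ++ w ++ apow a N)
  obtain ⟨m₁, m₂, e, -, L', hL', h2⟩ := exists_cut hN L hL u (apow a N) (w ++ apow a N ++ v)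
    (by simp) (by rw [← hLw]; simp)
  obtain ⟨m₃, m₄, e', h3, -⟩ := exists_cut hN L' hL' (m₂ ++ w) (apow a N) v
    (by simp) (by rw [← h2]; simp)
  have e1 := eq_apow_of_append_right e
  have e2 := eq_apow_of_append_left e'
  refine ⟨(m₂.length % n, m₃.length % n), mem_rel.2 ⟨Nat.mod_lt _ hn, Nat.mod_lt _ hn,
    m₂.length, m₃.length, ?_, (Nat.mod_modEq _ _).symm, (Nat.mod_modEq _ _).symm⟩⟩
  rw [pad, ← e1, ← e2]
  exact h3

theorem rel_mono {M N : Set (List A)} (h : M ⊆ N) (a : A) (n : ℕ) (w : List A) :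
    rel a n M w ⊆ rel a n N w := by
  intro x hx
  obtain ⟨h1, h2, i, j, hij, h3⟩ := mem_rel.1 hx
  exact mem_rel.2 ⟨h1, h2, i, j, star_mono h hij, h3⟩

/-- A finite complete code containing a power of a letter is maximal. -/
theorem IsComplete.isFiniteMaximalCode {M : Set (List A)} (hc : IsComplete M) {a : A} {n : ℕ}
    (hn : 0 < n) (hfin : M.Finite) (hM : UniquelyDecodable M) (h : apow a n ∈ M) :
    IsFiniteMaximalCode M := by
  refine ⟨hfin, hM, fun N hN hMN y hy => ?_⟩
  by_contra hyM
  set M' := insert y M with hM'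
  have hsub : M ⊆ M' := Set.subset_insert y M
  have hM'N : M' ⊆ N := Set.insert_subset hy hMN
  have hUD : UniquelyDecodable M' := uniquelyDecodable_mono hM'N hN
  have hcard := card_rel_eq hn hfin hM h (hc.rel_nonempty hn hfin) y
  have hcard' : #(rel a n M' y) ≤ n := card_rel_le hn (hfin.insert y) hUD (hsub h) y
  -- The residue set over `M` already has the maximal size `n`, so adding `y` cannot enlarge it. As
  -- `y` itself contributes `(0, 0)` over `M'`, some `a ^ (p * n) * y * a ^ (q * n)` is in `M*`, and
  -- comparing its two factorizations over `M'` shows that `y` was in `M`.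
  have heq : rel a n M y = rel a n M' y :=
    eq_of_subset_of_card_le (rel_mono hsub a n y) (by omega)
  have h0 : (0, 0) ∈ rel a n M' y := mem_rel.2 ⟨hn, hn, 0, 0,
    by simpa [pad] using subset_star M' (Set.mem_insert y M), rfl, rfl⟩
  rw [← heq] at h0
  obtain ⟨-, -, i, j, ⟨L, hL, hLy⟩, hi, hj⟩ := mem_rel.1 h0
  obtain ⟨p, rfl⟩ := (Nat.modEq_zero_iff_dvd).1 hi
  obtain ⟨q, rfl⟩ := (Nat.modEq_zero_iff_dvd).1 hj
  have := hUD L (List.replicate p (apow a n) ++ [y] ++ List.replicate q (apow a n))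
    (fun w hw => hsub (hL w hw))
    (by
      intro w hw
      simp only [List.mem_append, List.mem_singleton] at hw
      rcases hw with (hw | rfl) | hw
      · rw [List.eq_of_mem_replicate hw]; exact hsub h
      · exact Set.mem_insert _ _
      · rw [List.eq_of_mem_replicate hw]; exact hsub h)
    (by
      rw [← hLy, List.flatten_append, List.flatten_append, flatten_replicate_apow,
        flatten_replicate_apow, Nat.mul_comm n p, Nat.mul_comm n q]
      simp [pad])
  exact hyM (hL y (by rw [this]; simp))

/-- Adding to a code an unbordered word that is not a factor of its star yields a code. -/
theorem uniquelyDecodable_insert {M : Set (List A)} (hM : UniquelyDecodable M) {y : List A}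
    (hfac : ∀ u v, u ++ y ++ v ∉ star M)
    (hub : ∀ z v x, z ≠ [] → v ≠ [] → y = z ++ v → y ≠ v ++ x) :
    UniquelyDecodable (insert y M) := by
  have hsplit : ∀ L : List (List A), (∀ w ∈ L, w ∈ insert y M) → (∀ w ∈ L, w ∈ M) ∨
      ∃ P Q, L = P ++ y :: Q ∧ (∀ w ∈ P, w ∈ M) ∧ ∀ w ∈ Q, w ∈ insert y M := by
    intro L hL
    induction L with
    | nil => exact Or.inl (by simp)
    | cons x L ih =>
      rcases hL x (by simp) with rfl | hx
      · exact Or.inr ⟨[], L, rfl, by simp, fun w hw => hL w (by simp [hw])⟩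
      · rcases ih fun w hw => hL w (by simp [hw]) with h | ⟨P, Q, rfl, hP, hQ⟩
        · refine Or.inl fun w hw => ?_
          rcases List.mem_cons.1 hw with rfl | hw
          exacts [hx, h w hw]
        · refine Or.inr ⟨x :: P, Q, rfl, fun w hw => ?_, hQ⟩
          rcases List.mem_cons.1 hw with rfl | hw
          exacts [hx, hP w hw]
  -- The first occurrences of `y` in two factorizations start at the same place: otherwise either
  -- the earlier one lies inside a product of elements of `M`, or the two overlap and `y` has a
  -- border.
  have hpos : ∀ {P P' : List (List A)} {q q' : List A}, (∀ w ∈ P, w ∈ M) → (∀ w ∈ P', w ∈ M) →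
      P.flatten ++ (y ++ q) = P'.flatten ++ (y ++ q') → P'.flatten.length ≤ P.flatten.length →
      P.flatten = P'.flatten := by
    intro P P' q q' hP hP' he hl
    rcases List.append_eq_append_iff.1 he with ⟨z, h1, -⟩ | ⟨z, h1, h2⟩
    · rw [h1, List.length_append] at hl
      have : z = [] := List.eq_nil_of_length_eq_zero (by omega)
      rw [h1, this, List.append_nil]
    · by_cases hz : z = []
      · rw [h1, hz, List.append_nil]
      rcases List.append_eq_append_iff.1 h2 with ⟨v, h3, -⟩ | ⟨v, h3, h4⟩
      · refine absurd ?_ (hfac P'.flatten v)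
        rw [List.append_assoc, ← h3, ← h1]
        exact ⟨P, hP, rfl⟩
      · by_cases hv : v = []
        · refine absurd ?_ (hfac P'.flatten [])
          have : y = z := by rw [h3, hv, List.append_nil]
          rw [List.append_nil, this, ← h1]
          exact ⟨P, hP, rfl⟩
        · exfalso
          rcases List.append_eq_append_iff.1 h4 with ⟨x, h5, -⟩ | ⟨x, h5, -⟩
          · have := congrArg List.length h3
            have h6 := congrArg List.length h5
            have := List.length_pos_iff.2 hz
            simp only [List.length_append] at *
            omega
          · exact hub z v x hz hv h3 h5
  have main : ∀ k (L₁ L₂ : List (List A)), L₁.length = k → (∀ w ∈ L₁, w ∈ insert y M) →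
      (∀ w ∈ L₂, w ∈ insert y M) → L₁.flatten = L₂.flatten → L₁ = L₂ := by
    intro k
    induction k using Nat.strong_induction_on with
    | _ k ih =>
      intro L₁ L₂ hk h1 h2 he
      rcases hsplit L₁ h1 with h | ⟨P, Q, rfl, hP, hQ⟩ <;>
        rcases hsplit L₂ h2 with h' | ⟨P', Q', rfl, hP', hQ'⟩
      · exact hM _ _ h h' he
      · refine absurd (show L₁.flatten ∈ star M from ⟨L₁, h, rfl⟩) ?_
        rw [he, List.flatten_append, List.flatten_cons, ← List.append_assoc]
        exact hfac _ _
      · refine absurd (show L₂.flatten ∈ star M from ⟨L₂, h', rfl⟩) ?_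
        rw [← he, List.flatten_append, List.flatten_cons, ← List.append_assoc]
        exact hfac _ _
      · simp only [List.flatten_append, List.flatten_cons] at he
        have hPP : P.flatten = P'.flatten := by
          rcases le_total P'.flatten.length P.flatten.length with hl | hl
          · exact hpos hP hP' he hl
          · exact (hpos hP' hP he.symm hl).symm
        have hPP' := hM _ _ hP hP' hPP
        subst hPP'
        rw [ih Q.length (by rw [← hk]; simp; omega) Q Q' rfl hQ hQ'
          (List.append_cancel_left (List.append_cancel_left he))]
  exact fun L₁ L₂ => main _ L₁ L₂ rfl

/-- A maximal code is complete. -/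
theorem isComplete_of_maximal {a b : A} (hab : a ≠ b) {M : Set (List A)}
    (hM : Maximal UniquelyDecodable M) : IsComplete M := by
  classical
  intro w
  by_contra! hw
  cases w with
  | nil => exact hw [] [] (by simpa using nil_mem_star M)
  | cons c w' =>
    obtain ⟨d, hd⟩ : ∃ d, d ≠ c := by
      by_cases h : a = c
      · exact ⟨b, fun h' => hab (h.trans h'.symm)⟩
      · exact ⟨a, h⟩
    set w := c :: w' with hwdef
    have hfac : ∀ u v, u ++ (w ++ apow d w.length) ++ v ∉ star M := by
      intro u v
      have := hw u (apow d w.length ++ v)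
      simpa using this
    have hcd : ∀ k, (apow d k).count c = 0 := fun k =>
      List.count_eq_zero.2 fun h => hd (List.eq_of_mem_replicate h).symm
    -- The word `w * d ^ |w|`, with `d` other than the first letter `c` of `w`, is unbordered. A
    -- border starts with `c`, so as a suffix it is longer than `d ^ |w|`; as a prefix it then
    -- contains all of `w`, leaving no `c` for the nonempty part in front of it.
    have hUD := uniquelyDecodable_insert hM.prop hfac (by
      intro z v x hz hv h1 h2
      obtain ⟨e, z', rfl⟩ := List.exists_cons_of_ne_nil hz
      obtain ⟨f, v', rfl⟩ := List.exists_cons_of_ne_nil hv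
      have he : e = c := by
        rw [hwdef, List.cons_append, List.cons_append] at h1
        exact (List.cons.inj h1).1.symm
      have hf : f = c := by
        rw [hwdef, List.cons_append, List.cons_append] at h2
        exact (List.cons.inj h2).1.symm
      subst he hf
      rcases List.append_eq_append_iff.1 h2 with ⟨t, h3, -⟩ | ⟨t, h3, h4⟩
      · have c1 := congrArg (List.count f) h1
        rw [h3] at c1
        simp only [List.count_append, List.count_cons_self, hcd] at c1
        omega
      · rcases List.append_eq_append_iff.1 h1 with ⟨s, -, h5⟩ | ⟨s, h5, h6⟩
        · have : f ∈ apow d w.length := by rw [h5]; simp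
          exact hd (List.eq_of_mem_replicate this).symm
        · cases s with
          | nil =>
            have : f ∈ apow d w.length := by
              rw [List.nil_append] at h6
              rw [← h6]; simp
            exact hd (List.eq_of_mem_replicate this).symm
          | cons g s =>
            have l1 := congrArg List.length h3
            have l2 := congrArg List.length h6
            simp only [List.length_append, length_apow] at l1 l2
            simp only [List.length_cons] at l1 l2
            omega)
    have hmem := hM.le_of_ge hUD (Set.subset_insert _ M) (Set.mem_insert _ M)
    exact hfac [] [] (by simpa using subset_star M hmem)

/-! ### Compatible sets -/

theorem comp_cSet {a b : A} (hab : a ≠ b) {n : ℕ} (hn : 0 < n) {M : Set (List A)}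
    {w w' v : List A} {r : ℕ} (h : ∀ i l, (i, l) ∈ rel a n M v ↔
      ∃ j k, (i, j) ∈ rel a n M w ∧ (k, l) ∈ rel a n M w' ∧ (j + k) % n = r) :
    comp a b n r (cSet a b n M w) (cSet a b n M w') = cSet a b n M v := by
  ext u
  rw [cSet_eq_image a b hn M v]
  constructor
  · rintro ⟨i, j, k, l, h1, h2, h3, rfl⟩
    rw [bay_mem_cSet hab hn] at h1 h2
    exact ⟨(i, l), (h i l).2 ⟨j, k, h1, h2, h3⟩, rfl⟩
  · rintro ⟨⟨i, l⟩, hx, rfl⟩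
    obtain ⟨j, k, h1, h2, h3⟩ := (h i l).1 hx
    exact ⟨i, j, k, l, (bay_mem_cSet hab hn).2 h1, (bay_mem_cSet hab hn).2 h2, h3, rfl⟩

/-- For `M = {a ^ n} ∪ Y` the bound on residue sets forces `Y = C_M(b)`. Composing repeatedly with
it stays among the sets `C_M(v)` with `n` elements, all of which are cbc. -/
theorem IsCbc.isCompatible_singleton {a b : A} (hab : a ≠ b) {n : ℕ} (hn : 0 < n)
    {Y : Set (List A)} (hY : IsCbc a b n Y) : IsCompatible a b n {Y} := by
  obtain ⟨hform, hcard, hUD⟩ := hY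
  have hfinY : Y.Finite := Set.finite_of_ncard_pos (by omega)
  set M := {apow a n} ∪ Y with hM
  have hfin : M.Finite := (Set.finite_singleton _).union hfinY
  have ha : apow a n ∈ M := Or.inl rfl
  have hsub : Y ⊆ cSet a b n M [b] := by
    intro y hy
    obtain ⟨i, j, hi, hj, rfl⟩ := hform y hy
    exact ⟨i, j, subset_star M (Or.inr hy), by rw [Nat.mod_eq_of_lt hi, Nat.mod_eq_of_lt hj]⟩
  have hYc : Y = cSet a b n M [b] := by
    refine Set.eq_of_subset_of_ncard_le hsub ?_ (finite_cSet a b hn M [b])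
    rw [ncard_cSet hab hn, hcard]
    exact card_rel_le hn hfin hUD ha [b]
  have hb : #(rel a n M [b]) = n := by rw [← ncard_cSet hab hn, ← hYc, hcard]
  have main : ∀ (L : List (ℕ × Set (List A))), (∀ p ∈ L, p.1 < n ∧ p.2 ∈ ({Y} : Set _)) →
      ∀ w, #(rel a n M w) = n → ∃ v, #(rel a n M v) = n ∧
        L.foldl (fun Z p => comp a b n p.1 Z p.2) (cSet a b n M w) = cSet a b n M v := by
    intro L
    induction L with
    | nil => exact fun _ w hw => ⟨w, hw, rfl⟩
    | cons p L ih =>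
      intro hL w hw
      obtain ⟨hp, hpY⟩ := hL p (by simp)
      obtain ⟨v, hv, hv'⟩ := exists_comp_card_eq hn hfin hUD ha hw hb hp
      obtain ⟨v', h1, h2⟩ := ih (fun p hp => hL p (by simp [hp])) v hv
      refine ⟨v', h1, ?_⟩
      have h3 := comp_cSet hab hn hv'
      rw [← hYc] at h3
      rw [List.foldl_cons, Set.mem_singleton_iff.1 hpY, h3, h2]
  intro X hX L hL
  obtain ⟨v, hv, h⟩ := main L hL [b] hb
  rw [Set.mem_singleton_iff.1 hX]
  rw [← hYc] at h
  rw [h]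
  exact isCbc_cSet hab hn hUD ha hv

/-! ### Hajós codes -/

theorem dual_dual {a b : A} (hab : a ≠ b) {X : Set (List A)}
    (hX : ∀ w ∈ X, ∃ i j, w = bay a b i j) : dual a b (dual a b X) = X := by
  ext w
  constructor
  · rintro ⟨i, j, ⟨i', j', h, he⟩, rfl⟩
    obtain ⟨rfl, rfl⟩ := bay_inj hab he
    exact h
  · intro hw
    obtain ⟨i, j, rfl⟩ := hX w hw
    exact ⟨j, i, ⟨i, j, hw, rfl⟩, rfl⟩

theorem dual_singleton {a b : A} (hab : a ≠ b) : dual a b {[b]} = {[b]} := by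
  have h0 : [b] = bay a b 0 0 := by simp [bay, pad]
  ext w
  simp only [Set.mem_singleton_iff]
  constructor
  · rintro ⟨i, j, h, rfl⟩
    rw [Set.mem_singleton_iff, h0] at h
    obtain ⟨rfl, rfl⟩ := bay_inj hab h
    exact h0.symm
  · rintro rfl
    exact ⟨0, 0, h0.symm, h0⟩

theorem exists_eq_image_bay {a b : A} {m : ℕ} {X : Set (List A)}
    (hX : ∀ w ∈ X, ∃ i j, i < m ∧ j < m ∧ w = bay a b i j) :
    X = (fun x : ℕ × ℕ => bay a b x.1 x.2) '' {x | bay a b x.1 x.2 ∈ X} := by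
  ext w
  constructor
  · intro hw
    obtain ⟨i, j, -, -, rfl⟩ := hX w hw
    exact ⟨(i, j), hw, rfl⟩
  · rintro ⟨x, hx, rfl⟩
    exact hx

theorem add_mul_lt {i k m t : ℕ} (hi : i < m) (hk : k < t) : i + k * m < m * t := by
  calc i + k * m < m + k * m := by omega
    _ = m * (k + 1) := by ring
    _ ≤ m * t := Nat.mul_le_mul_left _ hk

theorem add_mul_inj {i i' k k' m : ℕ} (hi : i < m) (hi' : i' < m)
    (h : i + k * m = i' + k' * m) : i = i' ∧ k = k' := by
  have h1 := congrArg (· % m) h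
  have h2 := congrArg (· / m) h
  have hm : 0 < m := by omega
  simp only [Nat.add_mul_mod_self_right, Nat.mod_eq_of_lt hi, Nat.mod_eq_of_lt hi'] at h1
  simp only [Nat.add_mul_div_right _ _ hm, Nat.div_eq_of_lt hi, Nat.div_eq_of_lt hi'] at h2
  exact ⟨h1, by omega⟩

/-- The bounds on the exponents and the number of elements of a Hajós cbc. -/
theorem IsHajosCbc.bounds {a b : A} (hab : a ≠ b) {m : ℕ} {X : Set (List A)}
    (h : IsHajosCbc a b m X) :
    (∀ w ∈ X, ∃ i j, i < m ∧ j < m ∧ w = bay a b i j) ∧ X.ncard = m := by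
  have expand : ∀ {m t : ℕ} {X Y : Set (List A)},
      (∀ w ∈ X, ∃ i j, i < m ∧ j < m ∧ w = bay a b i j) ∧ X.ncard = m →
      IsExpansion a b m t X Y →
      (∀ w ∈ Y, ∃ i j, i < m * t ∧ j < m * t ∧ w = bay a b i j) ∧ Y.ncard = m * t := by
    rintro m t X Y ⟨hX, hcard⟩ ⟨k, hk, rfl⟩
    have hlt : ∀ {i j}, bay a b i j ∈ X → i < m ∧ j < m := by
      intro i j hij
      obtain ⟨i', j', hi', hj', he⟩ := hX _ hij
      obtain ⟨rfl, rfl⟩ := bay_inj hab he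
      exact ⟨hi', hj'⟩
    refine ⟨?_, ?_⟩
    · rintro _ ⟨i, j, s, hij, hs, rfl⟩
      exact ⟨_, _, add_mul_lt (hlt hij).1 (hk i j s), add_mul_lt (hlt hij).2 hs, rfl⟩
    · set f : (ℕ × ℕ) × ℕ → List A := fun x =>
        bay a b (x.1.1 + k x.1.1 x.1.2 x.2 * m) (x.1.2 + x.2 * m) with hf
      have himg : {w | ∃ i j s : ℕ, bay a b i j ∈ X ∧ s < t ∧
          w = bay a b (i + k i j s * m) (j + s * m)} =
          f '' ({x | bay a b x.1 x.2 ∈ X} ×ˢ Set.Iio t) := by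
        ext w
        constructor
        · rintro ⟨i, j, s, hij, hs, rfl⟩
          exact ⟨((i, j), s), ⟨hij, hs⟩, rfl⟩
        · rintro ⟨⟨⟨i, j⟩, s⟩, ⟨hij, hs⟩, rfl⟩
          exact ⟨i, j, s, hij, hs, rfl⟩
      rw [himg, Set.InjOn.ncard_image, Set.ncard_prod]
      · rw [← Set.ncard_image_of_injective {x : ℕ × ℕ | bay a b x.1 x.2 ∈ X} (bay_injective hab),
          ← exists_eq_image_bay hX, hcard]
        simp
      · rintro ⟨⟨i, j⟩, s⟩ ⟨hij, -⟩ ⟨⟨i', j'⟩, s'⟩ ⟨hij', -⟩ he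
        obtain ⟨h1, h2⟩ := bay_inj hab he
        obtain ⟨rfl, -⟩ := add_mul_inj (hlt hij).1 (hlt hij').1 h1
        obtain ⟨rfl, rfl⟩ := add_mul_inj (hlt hij).2 (hlt hij').2 h2
        rfl
  induction h with
  | one => exact ⟨fun w hw => ⟨0, 0, by omega, by omega, by simpa [bay, pad] using hw⟩, by simp⟩
  | right _ _ hY ih => exact expand ih hY
  | @left m t X Y _ _ hY ih =>
    obtain ⟨h1, h2⟩ := expand ih hY
    refine ⟨?_, ?_⟩
    · rintro _ ⟨i, j, hij, rfl⟩
      obtain ⟨i', j', hi', hj', he⟩ := h1 _ hij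
      obtain ⟨rfl, rfl⟩ := bay_inj hab he
      exact ⟨j, i, hj', hi', rfl⟩
    · have : dual a b Y = (fun x : ℕ × ℕ => bay a b x.2 x.1) '' {x | bay a b x.1 x.2 ∈ Y} := by
        ext w
        constructor
        · rintro ⟨i, j, hij, rfl⟩
          exact ⟨(i, j), hij, rfl⟩
        · rintro ⟨x, hx, rfl⟩
          exact ⟨_, _, hx, rfl⟩
      rw [this, Set.ncard_image_of_injective,
        ← Set.ncard_image_of_injective {x : ℕ × ℕ | bay a b x.1 x.2 ∈ Y} (bay_injective hab),
        ← exists_eq_image_bay h1, h2]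
      intro x y h
      exact Prod.ext (bay_inj hab h).2 (bay_inj hab h).1

theorem IsHajosCbc.dual {a b : A} (hab : a ≠ b) {m : ℕ} {X : Set (List A)}
    (h : IsHajosCbc a b m X) : IsHajosCbc a b m (dual a b X) := by
  cases h with
  | one => rw [dual_singleton hab]; exact .one
  | right ht hX hY => exact .left ht hX hY
  | left ht hX hY =>
    rw [dual_dual hab]
    · exact .right ht hX hY
    · intro w hw
      obtain ⟨i, j, -, -, h⟩ := (IsHajosCbc.bounds hab (.right ht hX hY)).1 w hw
      exact ⟨i, j, h⟩

/-- The duals between consecutive links are harmless because Hajós cbc are closed under duality. -/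
theorem HajosChain.isHajosCbc {a b : A} (hab : a ≠ b) : ∀ {ts : List ℕ} {Y : Set (List A)},
    (∀ t ∈ ts, 1 < t) → HajosChain a b ts Y → IsHajosCbc a b ts.prod Y
  | [], Y, _, h => by
    have : Y = {[b]} := h
    rw [this]
    exact .one
  | t :: ts, Y, ht, h => by
    obtain ⟨X, hX, hXY, hch⟩ := h
    have h1 := (HajosChain.isHajosCbc hab (fun s hs => ht s (by simp [hs])) hch).dual hab
    rw [dual_dual hab fun w hw => by
      obtain ⟨i, j, -, -, h⟩ := hX.1 w hw
      exact ⟨i, j, h⟩] at h1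
    rw [List.prod_cons, Nat.mul_comm]
    exact .right (ht t (by simp)) h1 hXY

theorem IsCbcHajosNumber.isHajosCbc {a b : A} (hab : a ≠ b) {n : ℕ} (hn : IsCbcHajosNumber a b n)
    {Y : Set (List A)} (hY : IsCbc a b n Y) : IsHajosCbc a b n Y := by
  obtain ⟨hn1, hn2⟩ := hn
  obtain ⟨ts, ht, h⟩ := hn2 {Y} (hY.isCompatible_singleton hab hn1)
  have h1 : IsHajosCbc a b ts.prod Y := by
    rcases h with h | h
    · exact (h Y rfl).isHajosCbc hab ht
    · have := ((h Y rfl).isHajosCbc hab ht).dual hab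
      rwa [dual_dual hab fun w hw => by
        obtain ⟨i, j, -, -, h⟩ := hY.1 w hw
        exact ⟨i, j, h⟩] at this
  -- The product of the chain parameters is identified with `n` by counting the elements of `Y`.
  have h2 := (h1.bounds hab).2
  rw [hY.2.1] at h2
  rwa [h2]

/-! ### Prefix and suffix codes made of padded letters -/

theorem isSuffixCode_reverse {D : Set (List A)} (h : IsPrefixCode D) :
    IsSuffixCode (List.reverse '' D) := by
  refine ⟨fun h0 => h.1 ?_, ?_⟩
  · have := congrArg (fun S => List.reverse '' S) h0
    simpa [Set.image_image] using this
  · rintro _ ⟨u, hu, rfl⟩ _ ⟨v, hv, rfl⟩ huv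
    rw [h.2 u hu v hv (List.reverse_suffix.1 huv)]

/-- The words `α ^ t` and `α ^ s * x * α ^ k` for `Q s x k`. -/
def padCode (α : A) (t : ℕ) (Q : ℕ → A → ℕ → Prop) : Set (List A) :=
  {apow α t} ∪ {w | ∃ s x k, Q s x k ∧ w = pad α s [x] k}

/-- The first letter other than `α` reveals `s` and `x`, and these determine `k`; since `s < t`, no
such word is comparable with `α ^ t`. -/
theorem isPrefixCode_padCode {α : A} {t : ℕ} (ht : 0 < t) {Q : ℕ → A → ℕ → Prop}
    (hQ : ∀ s x k, Q s x k → s < t ∧ α ≠ x) (hf : ∀ s x k k', Q s x k → Q s x k' → k = k') :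
    IsPrefixCode (padCode α t Q) := by
  have hp : ∀ s x k, pad α s [x] k = apow α s ++ x :: apow α k := fun s x k => by simp [pad]
  have hmix : ∀ {s x} {f f' : List A}, s < t → α ≠ x →
      apow α t ++ f ≠ apow α s ++ x :: f' := by
    intro s x f f' hs hx he
    obtain ⟨d, rfl⟩ := Nat.exists_eq_add_of_lt hs
    rw [Nat.add_assoc, apow_add, apow_succ] at he
    simp only [List.append_assoc, List.cons_append] at he
    have := List.append_cancel_left he
    simp only [List.cons.injEq] at this
    exact hx this.1
  refine ⟨fun h => ?_, ?_⟩
  · have : apow α t ∈ ({[]} : Set (List A)) := h ▸ Or.inl rfl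
    have := congrArg List.length (Set.mem_singleton_iff.1 this)
    simp at this
    omega
  · rintro u (rfl | ⟨s, x, k, hq, rfl⟩) v (rfl | ⟨s', x', k', hq', rfl⟩) ⟨f, hf'⟩
    · rfl
    · rw [hp] at hf'
      exact absurd hf' (hmix (hQ _ _ _ hq').1 (hQ _ _ _ hq').2)
    · rw [hp, List.append_assoc, List.cons_append] at hf'
      refine absurd hf'.symm ?_
      have := hmix (f := []) (f' := apow α k ++ f) (hQ _ _ _ hq).1 (hQ _ _ _ hq).2
      rwa [List.append_nil] at this
    · rw [hp, hp, List.append_assoc, List.cons_append] at hf'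
      obtain ⟨rfl, rfl, -⟩ := apow_append_cons_inj (hQ _ _ _ hq).2 (hQ _ _ _ hq').2 hf'
      rw [hf _ _ _ _ hq hq']

theorem reverse_pad (a : A) (i : ℕ) (w : List A) (j : ℕ) :
    (pad a i w j).reverse = pad a j w.reverse i := by
  simp [pad, apow]

theorem isSuffixCode_padCode {α : A} {t : ℕ} (ht : 0 < t) {Q : ℕ → A → ℕ → Prop}
    (hQ : ∀ k x s, Q k x s → s < t ∧ α ≠ x) (hf : ∀ k k' x s, Q k x s → Q k' x s → k = k') :
    IsSuffixCode (padCode α t Q) := by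
  have h := isSuffixCode_reverse (isPrefixCode_padCode (Q := fun s x k => Q k x s) ht
    (fun s x k h => hQ k x s h) fun s x k k' h h' => hf k k' x s h h')
  convert h using 1
  ext w
  constructor
  · rintro (rfl | ⟨k, x, s, hq, rfl⟩)
    · exact ⟨apow α t, Or.inl rfl, by simp [apow]⟩
    · exact ⟨_, Or.inr ⟨s, x, k, hq, rfl⟩, by simp [reverse_pad]⟩
  · rintro ⟨_, rfl | ⟨s, x, k, hq, rfl⟩, rfl⟩
    · exact Or.inl (by simp [apow])
    · exact Or.inr ⟨k, x, s, hq, by simp [reverse_pad]⟩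

theorem flatten_apow (a : A) (n k : ℕ) : (apow (apow a n) k).flatten = apow a (k * n) :=
  flatten_replicate_apow a n k

theorem flatten_pad (a : A) (m k s : ℕ) (x : List A) :
    (pad (apow a m) k [x] s).flatten = apow a (k * m) ++ x ++ apow a (s * m) := by
  simp [pad, flatten_apow]

/-- The words `a ^ m` and `a ^ i * ω * a ^ j` for `Z i j`. -/
def padWords (a : A) (m : ℕ) (ω : List A) (Z : ℕ → ℕ → Prop) : Set (List A) :=
  {apow a m} ∪ {w | ∃ i j, Z i j ∧ w = pad a i ω j}

theorem padWords_congr (a : A) (m : ℕ) (ω : List A) {Z Z' : ℕ → ℕ → Prop}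
    (h : ∀ i j, Z i j ↔ Z' i j) : padWords a m ω Z = padWords a m ω Z' := by
  simp only [padWords, h]

theorem pad_ne_apow {a : A} {ω : List A} (hω : ∀ k, ω ≠ apow a k) (i j k : ℕ) :
    apow a k ≠ pad a i ω j := fun h =>
  hω _ (eq_apow_of_append_right (eq_apow_of_append_left h ▸ rfl :
    apow a (apow a i ++ ω).length = apow a i ++ ω))

theorem flatten_image_padCode {a : A} {m t : ℕ} {ω : List A} {Q : ℕ → ℕ → ℕ → ℕ → Prop} :
    List.flatten '' padCode (apow a m) t
      (fun k x s => ∃ i j, Q i j k s ∧ x = pad a i ω j) =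
    padWords a (m * t) ω
      (fun i' j' => ∃ i j k s, Q i j k s ∧ i' = i + k * m ∧ j' = j + s * m) := by
  ext w
  constructor
  · rintro ⟨_, rfl | ⟨k, _, s, ⟨i, j, hq, rfl⟩, rfl⟩, rfl⟩
    · exact Or.inl (by rw [flatten_apow, Nat.mul_comm]; rfl)
    · refine Or.inr ⟨_, _, ⟨i, j, k, s, hq, rfl, rfl⟩, ?_⟩
      rw [flatten_pad, Nat.add_comm i, pad_add_left, pad_add_right, List.append_assoc]
  · rintro (rfl | ⟨_, _, ⟨i, j, k, s, hq, rfl, rfl⟩, rfl⟩)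
    · exact ⟨_, Or.inl rfl, by rw [flatten_apow, Nat.mul_comm]⟩
    · refine ⟨_, Or.inr ⟨k, pad a i ω j, s, ⟨i, j, hq, rfl⟩, rfl⟩, ?_⟩
      rw [flatten_pad, Nat.add_comm i, pad_add_left, pad_add_right, List.append_assoc]

theorem padCode_letters {a : A} {m t : ℕ} {ω : List A} {Z : ℕ → ℕ → Prop}
    {Q : ℕ → ℕ → ℕ → ℕ → Prop} (hZ : ∀ i j k s, Q i j k s → Z i j) :
    ∀ d ∈ padCode (apow a m) t (fun k x s => ∃ i j, Q i j k s ∧ x = pad a i ω j),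
      ∀ c ∈ d, c ∈ padWords a m ω Z := by
  rintro _ (rfl | ⟨k, _, s, ⟨i, j, hq, rfl⟩, rfl⟩) c hc
  · exact Or.inl (List.eq_of_mem_replicate hc)
  · simp only [pad, apow, List.mem_append, List.mem_singleton] at hc
    rcases hc with (hc | rfl) | hc
    · exact Or.inl (List.eq_of_mem_replicate hc)
    · exact Or.inr ⟨i, j, hZ _ _ _ _ hq, rfl⟩
    · exact Or.inl (List.eq_of_mem_replicate hc)

/-- Over the letters `a ^ m` and `a ^ i * ω * a ^ j`, the right exponent `s < t` and the letter
determine the left exponent `k`: this is the shape of a Hajós expansion. With `t = 1` the step only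
lengthens the left padding. -/
theorem isSuffixCodeOver_padWords {a : A} {m t : ℕ} (ht : 0 < t) {ω : List A}
    (hω : ∀ k, ω ≠ apow a k) {Z : ℕ → ℕ → Prop} {Q : ℕ → ℕ → ℕ → ℕ → Prop}
    (hZ : ∀ i j k s, Q i j k s → Z i j ∧ s < t)
    (hf : ∀ i j k k' s, Q i j k s → Q i j k' s → k = k') :
    IsSuffixCodeOver (padWords a m ω Z) (padWords a (m * t) ω
      (fun i' j' => ∃ i j k s, Q i j k s ∧ i' = i + k * m ∧ j' = j + s * m)) := by
  refine ⟨_, padCode_letters fun i j k s h => (hZ i j k s h).1, isSuffixCode_padCode ht ?_ ?_,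
    flatten_image_padCode.symm⟩
  · rintro k _ s ⟨i, j, hq, rfl⟩
    exact ⟨(hZ _ _ _ _ hq).2, pad_ne_apow hω _ _ _⟩
  · rintro k k' _ s ⟨i, j, hq, rfl⟩ ⟨i', j', hq', he⟩
    obtain ⟨rfl, rfl⟩ := pad_inj hω he
    exact hf _ _ _ _ _ hq hq'

theorem isPrefixCodeOver_padWords {a : A} {m t : ℕ} (ht : 0 < t) {ω : List A}
    (hω : ∀ k, ω ≠ apow a k) {Z : ℕ → ℕ → Prop} {Q : ℕ → ℕ → ℕ → ℕ → Prop}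
    (hZ : ∀ i j s k, Q i j s k → Z i j ∧ s < t)
    (hf : ∀ i j s k k', Q i j s k → Q i j s k' → k = k') :
    IsPrefixCodeOver (padWords a m ω Z) (padWords a (m * t) ω
      (fun i' j' => ∃ i j s k, Q i j s k ∧ i' = i + s * m ∧ j' = j + k * m)) := by
  refine ⟨_, padCode_letters fun i j k s h => (hZ i j k s h).1, isPrefixCode_padCode ht ?_ ?_,
    flatten_image_padCode.symm⟩
  · rintro s _ k ⟨i, j, hq, rfl⟩
    exact ⟨(hZ _ _ _ _ hq).2, pad_ne_apow hω _ _ _⟩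
  · rintro s _ k k' ⟨i, j, hq, rfl⟩ ⟨i', j', hq', he⟩
    obtain ⟨rfl, rfl⟩ := pad_inj hω he
    exact hf _ _ _ _ _ hq hq'

/-! ### From Hajós codes to prefix-suffix codes -/

theorem exists_eq_apow_append (a : A) (w : List A) :
    (∃ k, w = apow a k) ∨ ∃ p c v, a ≠ c ∧ w = apow a p ++ c :: v := by
  induction w with
  | nil => exact Or.inl ⟨0, rfl⟩
  | cons x w ih =>
    by_cases hx : a = x
    · subst hx
      rcases ih with ⟨k, rfl⟩ | ⟨p, c, v, hc, rfl⟩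
      · exact Or.inl ⟨k + 1, rfl⟩
      · exact Or.inr ⟨p + 1, c, v, hc, rfl⟩
    · exact Or.inr ⟨0, x, w, hx, rfl⟩

/-- Write `ω = a ^ p * c * v` with `c ≠ a`. Then `{a, c * v}` is a prefix code over the alphabet,
and `{a, ω}` is a suffix code over it. -/
theorem isPrefixSuffixCode_letter_word {a : A} {ω : List A} (hω : ∀ k, ω ≠ apow a k) :
    IsPrefixSuffixCode (padWords a 1 ω fun i j => i = 0 ∧ j = 0) := by
  obtain ⟨k, hk⟩ | ⟨p, c, v, hc, rfl⟩ := exists_eq_apow_append a ω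
  · exact absurd hk (hω k)
  have hcv : ∀ k, c :: v ≠ apow a k := fun k h =>
    hc (List.eq_of_mem_replicate (h ▸ List.mem_cons_self : c ∈ apow a k)).symm
  have h1 : IsPrefixSuffixCode (padWords a 1 (c :: v) fun i j => i = 0 ∧ j = 0) := by
    refine .prefixStep .base ⟨List.map (fun x => [x]) '' {[a], c :: v}, ?_, ⟨?_, ?_⟩, ?_⟩
    · rintro _ ⟨w, -, rfl⟩ x hx
      obtain ⟨y, -, rfl⟩ := List.mem_map.1 hx
      exact ⟨y, rfl⟩
    · intro h
      have : List.map (fun x => [x]) [a] ∈ ({[]} : Set (List (List A))) := h ▸ ⟨[a], by simp, rfl⟩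
      simp at this
    · rintro _ ⟨u, rfl | rfl, rfl⟩ _ ⟨w, rfl | rfl, rfl⟩ h
      · rfl
      · simp [hc] at h
      · have := hc.symm
        simp [this] at h
      · rfl
    · rw [Set.image_image]
      have : ∀ w : List A, (List.map (fun x => [x]) w).flatten = w := fun w => by
        induction w with
        | nil => rfl
        | cons x w ih => rw [List.map_cons, List.flatten_cons, ih]; rfl
      simp only [this, Set.image_id']
      ext w
      constructor
      · rintro (rfl | ⟨_, _, ⟨rfl, rfl⟩, rfl⟩)
        · exact Or.inl rfl
        · exact Or.inr (by simp [pad])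
      · rintro (rfl | rfl)
        · exact Or.inl rfl
        · exact Or.inr ⟨0, 0, ⟨rfl, rfl⟩, by simp [pad]⟩
  have h2 := isSuffixCodeOver_padWords (m := 1) (t := 1) one_pos hcv
    (Z := fun i j => i = 0 ∧ j = 0) (Q := fun i j k s => i = 0 ∧ j = 0 ∧ k = p ∧ s = 0)
    (fun i j k s h => ⟨⟨h.1, h.2.1⟩, by omega⟩) (fun i j k k' s h h' => by omega)
  have h3 : IsPrefixSuffixCode _ := .suffixStep h1 h2
  refine (?_ : padWords a 1 (apow a p ++ c :: v) _ = _) ▸ h3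
  ext w
  constructor
  · rintro (rfl | ⟨_, _, ⟨rfl, rfl⟩, rfl⟩)
    · exact Or.inl rfl
    · exact Or.inr ⟨p, 0, ⟨0, 0, p, 0, ⟨rfl, rfl, rfl, rfl⟩, by simp, by simp⟩, by simp [pad]⟩
  · rintro (rfl | ⟨_, _, ⟨_, _, _, _, ⟨rfl, rfl, rfl, rfl⟩, rfl, rfl⟩, rfl⟩)
    · exact Or.inl rfl
    · exact Or.inr ⟨0, 0, ⟨rfl, rfl⟩, by simp [pad]⟩

/-- `X` and its dual are treated together, so that dualizing only swaps the two claims. An expansion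
is a suffix step for the first and a prefix step for the second. -/
theorem IsHajosCbc.isPrefixSuffixCode {a b : A} (hab : a ≠ b) {ω : List A}
    (hω : ∀ k, ω ≠ apow a k) {m : ℕ} {X : Set (List A)} (h : IsHajosCbc a b m X) :
    IsPrefixSuffixCode (padWords a m ω fun i j => bay a b i j ∈ X) ∧
      IsPrefixSuffixCode (padWords a m ω fun i j => bay a b j i ∈ X) := by
  have expand : ∀ {m t : ℕ} {X Y : Set (List A)}, 1 < t →
      IsPrefixSuffixCode (padWords a m ω fun i j => bay a b i j ∈ X) ∧
        IsPrefixSuffixCode (padWords a m ω fun i j => bay a b j i ∈ X) →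
      IsExpansion a b m t X Y →
      IsPrefixSuffixCode (padWords a (m * t) ω fun i j => bay a b i j ∈ Y) ∧
        IsPrefixSuffixCode (padWords a (m * t) ω fun i j => bay a b j i ∈ Y) := by
    rintro m t X Y ht ⟨h1, h2⟩ ⟨k, -, rfl⟩
    constructor
    · have h3 := isSuffixCodeOver_padWords (m := m) (t := t) (by omega) hω
        (Z := fun i j => bay a b i j ∈ X)
        (Q := fun i j k' s => bay a b i j ∈ X ∧ s < t ∧ k' = k i j s)
        (fun i j k s h => ⟨h.1, h.2.1⟩) (fun i j k k' s h h' => h.2.2.trans h'.2.2.symm)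
      convert (show IsPrefixSuffixCode _ from .suffixStep h1 h3) using 2
      refine funext₂ fun i' j' => propext ⟨?_, ?_⟩
      · rintro ⟨i, j, s, hij, hs, he⟩
        obtain ⟨rfl, rfl⟩ := bay_inj hab he
        exact ⟨i, j, _, s, ⟨hij, hs, rfl⟩, rfl, rfl⟩
      · rintro ⟨i, j, _, s, ⟨hij, hs, rfl⟩, rfl, rfl⟩
        exact ⟨i, j, s, hij, hs, rfl⟩
    · have h3 := isPrefixCodeOver_padWords (m := m) (t := t) (by omega) hω
        (Z := fun i j => bay a b j i ∈ X)
        (Q := fun i j s k' => bay a b j i ∈ X ∧ s < t ∧ k' = k j i s)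
        (fun i j s k h => ⟨h.1, h.2.1⟩) (fun i j s k k' h h' => h.2.2.trans h'.2.2.symm)
      convert (show IsPrefixSuffixCode _ from .prefixStep h2 h3) using 2
      refine funext₂ fun i' j' => propext ⟨?_, ?_⟩
      · rintro ⟨i, j, s, hij, hs, he⟩
        obtain ⟨rfl, rfl⟩ := bay_inj hab he
        exact ⟨j, i, s, _, ⟨hij, hs, rfl⟩, rfl, rfl⟩
      · rintro ⟨i, j, s, _, ⟨hij, hs, rfl⟩, rfl, rfl⟩
        exact ⟨j, i, s, hij, hs, rfl⟩
  induction h with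
  | one =>
    have h0 : [b] = bay a b 0 0 := by simp [bay, pad]
    have h1 : ∀ i j, bay a b i j ∈ ({[b]} : Set (List A)) ↔ i = 0 ∧ j = 0 := by
      intro i j
      rw [Set.mem_singleton_iff, h0]
      exact ⟨bay_inj hab, by rintro ⟨rfl, rfl⟩; rfl⟩
    rw [padWords_congr a 1 ω h1, padWords_congr a 1 ω (fun i j => (h1 j i).trans and_comm)]
    exact ⟨isPrefixSuffixCode_letter_word hω, isPrefixSuffixCode_letter_word hω⟩
  | right ht _ hY ih => exact expand ht ih hY
  | @left m t X Y ht _ hY ih =>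
    have h1 : ∀ i j, bay a b i j ∈ BayonetCode.dual a b Y ↔ bay a b j i ∈ Y := by
      intro i j
      constructor
      · rintro ⟨i', j', hij, he⟩
        obtain ⟨rfl, rfl⟩ := bay_inj hab he
        exact hij
      · exact fun hij => ⟨j, i, hij, rfl⟩
    rw [padWords_congr a _ ω h1, padWords_congr a _ ω fun i j => h1 j i]
    exact (expand ht ih hY).symm

/-- In a code `{a ^ n} ∪ X`, a word `a ^ i * ω * a ^ j` of `X` is determined by the residues of its
exponents. -/
theorem eq_of_modEq {a : A} {n : ℕ} {ω : List A} (hω : ∀ k, ω ≠ apow a k) {X : Set (List A)}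
    (hcode : UniquelyDecodable ({apow a n} ∪ X)) {i j i' j' : ℕ} (h : pad a i ω j ∈ X)
    (h' : pad a i' ω j' ∈ X) (hi : i ≡ i' [MOD n]) (hj : j ≡ j' [MOD n]) : i = i' ∧ j = j' := by
  have hmem : ∀ {x : List A} (p q : ℕ), x ∈ X →
      ∀ w ∈ apow (apow a n) p ++ x :: apow (apow a n) q, w ∈ {apow a n} ∪ X := by
    intro x p q hx w hw
    rcases List.mem_append.1 hw with hw | hw
    · exact Or.inl (List.eq_of_mem_replicate hw)
    · rcases List.mem_cons.1 hw with rfl | hw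
      · exact Or.inr hx
      · exact Or.inl (List.eq_of_mem_replicate hw)
  have hflat : ∀ i j p q, (apow (apow a n) p ++ pad a i ω j :: apow (apow a n) q).flatten =
      pad a (p * n + i) ω (j + q * n) := by
    intro i j p q
    rw [List.flatten_append, List.flatten_cons, flatten_apow, flatten_apow, pad_add_left,
      pad_add_right]
  -- Adding `i' / n` blocks to the first word and `i / n` to the second equalizes the left
  -- exponents, since their residues agree; likewise on the right.
  have key := hcode _ _ (hmem (i' / n) (j' / n) h) (hmem (i / n) (j / n) h') (by
    rw [hflat, hflat]
    congr 1
    · have e1 := Nat.div_add_mod' i n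
      have e2 := Nat.div_add_mod' i' n
      have e3 : i % n = i' % n := hi
      omega
    · have e1 := Nat.div_add_mod' j n
      have e2 := Nat.div_add_mod' j' n
      have e3 : j % n = j' % n := hj
      omega)
  exact pad_inj hω
    (apow_append_cons_inj (pad_ne_apow hω _ _ _) (pad_ne_apow hω _ _ _) key).2.1

/-- The words with reduced exponents come from `Y`. A suffix step with `t = 1` restores the left
exponents and a prefix step with `t = 1` the right ones; `eq_of_modEq` makes the added multiples of
`n` unique. -/
theorem IsHajosCbc.isPrefixSuffixCode_of_cSet_subset {a b : A} (hab : a ≠ b) {n : ℕ} (hn : 0 < n)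
    {ω : List A} (hω : ∀ k, ω ≠ apow a k) {X : Set (List A)}
    (hX : ∀ x ∈ X, ∃ i j, x = pad a i ω j) (hcode : UniquelyDecodable ({apow a n} ∪ X))
    {Y : Set (List A)} (hY : IsHajosCbc a b n Y) (hsub : cSet a b n X ω ⊆ Y) :
    IsPrefixSuffixCode ({apow a n} ∪ X) := by
  have hmod : ∀ x y : ℕ, x + y * n ≡ x [MOD n] := fun x y => by simp [Nat.ModEq]
  have h1 := isSuffixCodeOver_padWords (m := n) (t := 1) one_pos hω
    (Z := fun i j => bay a b i j ∈ Y)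
    (Q := fun i j k s => s = 0 ∧ i < n ∧ j < n ∧ ∃ q, pad a (i + k * n) ω (j + q * n) ∈ X)
    (by
      rintro i j k s ⟨rfl, hi, hj, q, h⟩
      refine ⟨hsub ⟨_, _, subset_star X h, ?_⟩, one_pos⟩
      simp [Nat.mod_eq_of_lt hi, Nat.mod_eq_of_lt hj])
    (by
      rintro i j k k' s ⟨rfl, -, -, q, h⟩ ⟨-, -, -, q', h'⟩
      have := (eq_of_modEq hω hcode h h' ((hmod _ _).trans (hmod _ _).symm)
        ((hmod _ _).trans (hmod _ _).symm)).1
      exact Nat.eq_of_mul_eq_mul_right hn (Nat.add_left_cancel this))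
  have h2 := IsPrefixSuffixCodeOver.suffixStep (hY.isPrefixSuffixCode hab hω).1 h1
  rw [Nat.mul_one] at h2
  have h3 := isPrefixCodeOver_padWords (m := n) (t := 1) one_pos hω
    (Z := fun i' j' => ∃ i j k s, (s = 0 ∧ i < n ∧ j < n ∧
      ∃ q, pad a (i + k * n) ω (j + q * n) ∈ X) ∧ i' = i + k * n ∧ j' = j + s * n)
    (Q := fun i j s k => s = 0 ∧ j < n ∧ pad a i ω (j + k * n) ∈ X)
    (by
      rintro i j s k ⟨rfl, hj, h⟩
      refine ⟨⟨i % n, j, i / n, 0, ⟨rfl, Nat.mod_lt _ hn, hj, k, ?_⟩, ?_, by simp⟩, one_pos⟩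
      · rwa [Nat.mod_add_div']
      · rw [Nat.mod_add_div'])
    (by
      rintro i j s k k' ⟨rfl, -, h⟩ ⟨-, -, h'⟩
      have := (eq_of_modEq hω hcode h h' rfl ((hmod _ _).trans (hmod _ _).symm)).2
      exact Nat.eq_of_mul_eq_mul_right hn (Nat.add_left_cancel this))
  have h4 : IsPrefixSuffixCode _ := .prefixStep h2 h3
  rw [Nat.mul_one] at h4
  convert h4 using 2
  rw [padWords]
  congr 1
  ext w
  constructor
  · intro hw
    obtain ⟨i, j, rfl⟩ := hX w hw
    exact ⟨i, j, ⟨i, j % n, 0, j / n, ⟨rfl, Nat.mod_lt _ hn, by rwa [Nat.mod_add_div']⟩, by simp,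
      by rw [Nat.mod_add_div']⟩, rfl⟩
  · rintro ⟨_, _, ⟨i, j, _, k, ⟨rfl, hj, h⟩, rfl, rfl⟩, rfl⟩
    simpa using h

/-! ### Embedding prefix-suffix codes in finite complete codes -/

theorem uniquelyDecodable_of_prefixFree {D : Set (List A)} (h0 : [] ∉ D)
    (hD : ∀ u ∈ D, ∀ v ∈ D, u <+: v → u = v) : UniquelyDecodable D := by
  intro L₁
  induction L₁ with
  | nil =>
    intro L₂ _ h2 he
    cases L₂ with
    | nil => rfl
    | cons x L =>
      have he' := he.symm
      simp only [List.flatten_cons, List.flatten_nil, List.append_eq_nil_iff] at he'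
      exact absurd (he'.1 ▸ h2 x (by simp)) h0
  | cons x L₁ ih =>
    intro L₂ h1 h2 he
    cases L₂ with
    | nil =>
      simp only [List.flatten_cons, List.flatten_nil, List.append_eq_nil_iff] at he
      exact absurd (he.1 ▸ h1 x (by simp)) h0
    | cons y L₂ =>
      have hx := h1 x (by simp)
      have hy := h2 y (by simp)
      rw [List.flatten_cons, List.flatten_cons] at he
      have hxy : x = y := by
        rcases List.append_eq_append_iff.1 he with ⟨z, h, -⟩ | ⟨z, h, -⟩
        · exact hD x hx y hy ⟨z, h.symm⟩
        · exact (hD y hy x hx ⟨z, h.symm⟩).symm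
      subst hxy
      rw [ih L₂ (fun v hv => h1 v (by simp [hv])) (fun v hv => h2 v (by simp [hv]))
        (List.append_cancel_left he)]

theorem finite_words_of_length {M : Set A} (hM : M.Finite) (N : ℕ) :
    {w : List A | (∀ x ∈ w, x ∈ M) ∧ w.length = N}.Finite := by
  have := hM.to_subtype
  refine ((List.finite_length_eq M N).image (List.map Subtype.val)).subset ?_
  rintro w ⟨hw, hl⟩
  lift w to List M using hw
  exact ⟨w, by simpa using hl, rfl⟩

/-- A finite prefix code over a finite alphabet is included in a finite right complete prefix
code. -/
theorem exists_complete_prefixCode {M : Set A} (hM : M.Finite) {D : Set (List A)}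
    (hfin : D.Finite) (hDM : ∀ d ∈ D, ∀ c ∈ d, c ∈ M) (h0 : [] ∉ D)
    (hD : ∀ u ∈ D, ∀ v ∈ D, u <+: v → u = v) :
    ∃ D' : Set (List A), D ⊆ D' ∧ D'.Finite ∧ (∀ d ∈ D', ∀ c ∈ d, c ∈ M) ∧ UniquelyDecodable D' ∧
      ∀ w, (∀ c ∈ w, c ∈ M) → ∃ v, w ++ v ∈ star D' := by
  obtain ⟨N₀, hN₀⟩ := exists_length_le hfin
  obtain ⟨N, hN, hNpos⟩ : ∃ N, (∀ d ∈ D, d.length ≤ N) ∧ 0 < N :=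
    ⟨N₀ + 1, fun d hd => (hN₀ d hd).trans (by omega), by omega⟩
  -- `D` is filled up with the words of length `N` that have no prefix in `D`. As `N` bounds the
  -- lengths in `D`, the result is still prefix-free, and `N > 0` keeps the empty word out.
  set D' := D ∪ {w | ((∀ x ∈ w, x ∈ M) ∧ w.length = N) ∧ ∀ d ∈ D, ¬ d <+: w} with hD'
  have hne : [] ∉ D' := by
    rintro (h | ⟨⟨-, h⟩, -⟩)
    · exact h0 h
    · simp only [List.length_nil] at h
      omega
  refine ⟨D', Set.subset_union_left, hfin.union ((finite_words_of_length hM N).subset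
    fun w hw => hw.1), ?_, uniquelyDecodable_of_prefixFree hne ?_, ?_⟩
  · rintro d (hd | hd)
    exacts [hDM d hd, hd.1.1]
  · rintro u (hu | hu) v (hv | hv) huv
    · exact hD u hu v hv huv
    · exact absurd huv (hv.2 u hu)
    · exact huv.eq_of_length (le_antisymm huv.length_le (by rw [hu.1.2]; exact hN v hv))
    · exact huv.eq_of_length (hu.1.2.trans hv.1.2.symm)
  · have main : ∀ k (w : List A), w.length = k → (∀ c ∈ w, c ∈ M) → ∃ v, w ++ v ∈ star D' := by
      intro k
      induction k using Nat.strong_induction_on with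
      | _ k ih =>
        intro w hk hw
        cases w with
        | nil => exact ⟨[], nil_mem_star D'⟩
        | cons c w' =>
          set w := c :: w' with hwdef
          -- Prolonged by `N` letters, `w` has a prefix in `D'`. Either this prefix already covers
          -- `w`, or it is stripped off and the shorter remainder is treated.
          have hW : ∀ x ∈ w ++ apow c N, x ∈ M := by
            intro x hx
            rcases List.mem_append.1 hx with h | h
            · exact hw x h
            · rw [List.eq_of_mem_replicate h]
              exact hw c (by simp [hwdef])
          obtain ⟨d, hd, hdp⟩ : ∃ d ∈ D', d <+: w ++ apow c N := by
            by_cases hex : ∃ d ∈ D, d <+: (w ++ apow c N).take N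
            · obtain ⟨d, hd, hdp⟩ := hex
              exact ⟨d, Or.inl hd, hdp.trans (List.take_prefix _ _)⟩
            · refine ⟨(w ++ apow c N).take N, Or.inr ⟨⟨fun x hx => hW x (List.mem_of_mem_take hx),
                ?_⟩, fun d hd hdp => hex ⟨d, hd, hdp⟩⟩, List.take_prefix _ _⟩
              rw [List.length_take, List.length_append, length_apow]
              omega
          have hdne : d ≠ [] := fun h => hne (h ▸ hd)
          have hdpos := List.length_pos_iff.2 hdne
          obtain ⟨t, ht⟩ := hdp
          rcases List.append_eq_append_iff.1 ht with ⟨z, hz, -⟩ | ⟨z, hz, -⟩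
          · obtain ⟨v, hv⟩ := ih z.length (by
              have := congrArg List.length hz
              rw [List.length_append] at this
              omega) z rfl fun x hx => hw x (by rw [hz]; simp [hx])
            refine ⟨v, ?_⟩
            rw [hz, List.append_assoc]
            exact append_mem_star (subset_star D' hd) hv
          · exact ⟨z, hz ▸ subset_star D' hd⟩
    exact fun w => main _ w rfl

theorem reverse_flatten_eq (L : List (List A)) :
    L.flatten.reverse = (L.map List.reverse).reverse.flatten := List.reverse_flatten

theorem reverse_mem_star {D : Set (List A)} {w : List A} (h : w ∈ star D) :
    w.reverse ∈ star (List.reverse '' D) := by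
  obtain ⟨L, hL, rfl⟩ := h
  refine ⟨_, ?_, reverse_flatten_eq L⟩
  intro v hv
  obtain ⟨x, hx, rfl⟩ := List.mem_map.1 (List.mem_reverse.1 hv)
  exact ⟨x, hL x hx, rfl⟩

theorem uniquelyDecodable_reverse {D : Set (List A)} (hD : UniquelyDecodable D) :
    UniquelyDecodable (List.reverse '' D) := by
  intro L₁ L₂ h1 h2 he
  have hmem : ∀ {L : List (List A)}, (∀ w ∈ L, w ∈ List.reverse '' D) →
      ∀ w ∈ (L.map List.reverse).reverse, w ∈ D := by
    intro L hL w hw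
    obtain ⟨x, hx, rfl⟩ := List.mem_map.1 (List.mem_reverse.1 hw)
    obtain ⟨y, hy, rfl⟩ := hL x hx
    rwa [List.reverse_reverse]
  have := hD _ _ (hmem h1) (hmem h2) (by rw [← reverse_flatten_eq, ← reverse_flatten_eq, he])
  exact List.map_injective_iff.2 List.reverse_injective (List.reverse_injective this)

theorem exists_complete_suffixCode {M : Set A} (hM : M.Finite) {D : Set (List A)}
    (hfin : D.Finite) (hDM : ∀ d ∈ D, ∀ c ∈ d, c ∈ M) (h0 : [] ∉ D)
    (hD : ∀ u ∈ D, ∀ v ∈ D, u <:+ v → u = v) :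
    ∃ D' : Set (List A), D ⊆ D' ∧ D'.Finite ∧ (∀ d ∈ D', ∀ c ∈ d, c ∈ M) ∧ UniquelyDecodable D' ∧
      ∀ w, (∀ c ∈ w, c ∈ M) → ∃ v, v ++ w ∈ star D' := by
  obtain ⟨D', h1, h2, h3, h4, h5⟩ := exists_complete_prefixCode (D := List.reverse '' D) hM
    (hfin.image _)
    (by rintro _ ⟨d, hd, rfl⟩ c hc; exact hDM d hd c (List.mem_reverse.1 hc))
    (by rintro ⟨d, hd, he⟩; exact h0 (List.reverse_eq_nil_iff.1 he ▸ hd))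
    (by
      rintro _ ⟨u, hu, rfl⟩ _ ⟨v, hv, rfl⟩ h
      rw [hD u hu v hv (List.reverse_prefix.1 h)])
  refine ⟨List.reverse '' D', ?_, h2.image _, ?_, uniquelyDecodable_reverse h4, ?_⟩
  · exact fun d hd => ⟨d.reverse, h1 ⟨d, hd, rfl⟩, List.reverse_reverse d⟩
  · rintro _ ⟨d, hd, rfl⟩ c hc
    exact h3 d hd c (List.mem_reverse.1 hc)
  · intro w hw
    obtain ⟨v, hv⟩ := h5 w.reverse fun c hc => hw c (List.mem_reverse.1 hc)
    refine ⟨v.reverse, ?_⟩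
    simpa using reverse_mem_star hv

theorem flatten_flatten_mem {D : Set (List (List A))} {T : List (List A)} (h : T ∈ star D) :
    T.flatten ∈ star (List.flatten '' D) := by
  obtain ⟨L, hL, rfl⟩ := h
  refine ⟨L.map List.flatten, ?_, List.flatten_flatten⟩
  intro v hv
  obtain ⟨x, hx, rfl⟩ := List.mem_map.1 hv
  exact ⟨x, hL x hx, rfl⟩

/-- A composition of codes is a code. -/
theorem uniquelyDecodable_flatten {M : Set (List A)} (hM : UniquelyDecodable M)
    {D : Set (List (List A))} (hD : UniquelyDecodable D) (hDM : ∀ d ∈ D, ∀ c ∈ d, c ∈ M) :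
    UniquelyDecodable (List.flatten '' D) := by
  have hlift : ∀ {L : List (List A)}, (∀ w ∈ L, w ∈ List.flatten '' D) →
      ∃ T : List (List (List A)), (∀ d ∈ T, d ∈ D) ∧ L = T.map List.flatten := by
    intro L
    induction L with
    | nil => exact fun _ => ⟨[], by simp, rfl⟩
    | cons x L ih =>
      intro hL
      obtain ⟨d, hd, rfl⟩ := hL x (by simp)
      obtain ⟨T, hT, rfl⟩ := ih fun w hw => hL w (by simp [hw])
      refine ⟨d :: T, fun e he => ?_, rfl⟩
      rcases List.mem_cons.1 he with rfl | he
      exacts [hd, hT e he]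
  have hmem : ∀ {T : List (List (List A))}, (∀ d ∈ T, d ∈ D) → ∀ c ∈ T.flatten, c ∈ M := by
    intro T hT c hc
    obtain ⟨d, hd, hcd⟩ := List.mem_flatten.1 hc
    exact hDM d (hT d hd) c hcd
  intro L₁ L₂ h1 h2 he
  obtain ⟨T₁, hT₁, rfl⟩ := hlift h1
  obtain ⟨T₂, hT₂, rfl⟩ := hlift h2
  rw [← List.flatten_flatten, ← List.flatten_flatten] at he
  rw [hD T₁ T₂ hT₁ hT₂ (hM _ _ (hmem hT₁) (hmem hT₂) he)]

theorem IsComplete.flatten {M : Set (List A)} (hM : IsComplete M) {D : Set (List (List A))}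
    (hD : ∀ w, (∀ c ∈ w, c ∈ M) → ∃ u v, u ++ w ++ v ∈ star D) :
    IsComplete (List.flatten '' D) := by
  intro w
  obtain ⟨u, v, L, hL, he⟩ := hM w
  obtain ⟨u', v', h⟩ := hD L hL
  have := flatten_flatten_mem h
  rw [List.flatten_append, List.flatten_append, ← he] at this
  exact ⟨u'.flatten ++ u, v ++ v'.flatten, by simpa using this⟩

/-- Every finite subset of a prefix-suffix code over a finite alphabet is included in a finite
complete code. -/
theorem IsPrefixSuffixCode.exists_complete [Finite A] {C : Set (List A)}
    (hC : IsPrefixSuffixCode C) : ∀ F : Set (List A), F.Finite → F ⊆ C →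
      ∃ M, F ⊆ M ∧ M.Finite ∧ UniquelyDecodable M ∧ IsComplete M := by
  -- Codes in the tower may be infinite, but a finite subset uses only finitely many words of the
  -- level below, to which the induction hypothesis applies.
  have lift : ∀ {C : Set (List A)} {D : Set (List (List A))} {F : Set (List A)}, F.Finite →
      F ⊆ List.flatten '' D → (∀ d ∈ D, ∀ c ∈ d, c ∈ C) →
      ∃ D₀ ⊆ D, D₀.Finite ∧ F ⊆ List.flatten '' D₀ ∧
        {c | ∃ d ∈ D₀, c ∈ d}.Finite ∧ {c | ∃ d ∈ D₀, c ∈ d} ⊆ C := by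
    intro C D F hF hFD hDC
    have hFD' : ∀ x ∈ F, ∃ d, d ∈ D ∧ d.flatten = x := fun x hx => hFD hx
    choose! g hg hg' using hFD'
    have hfin := hF.image g
    refine ⟨g '' F, ?_, hfin, fun x hx => ⟨g x, ⟨x, hx, rfl⟩, hg' x hx⟩, ?_, ?_⟩
    · rintro _ ⟨x, hx, rfl⟩
      exact hg x hx
    · have : {c | ∃ d ∈ g '' F, c ∈ d} = ⋃ d ∈ g '' F, {c | c ∈ d} := by
        ext c
        simp
      rw [this]
      exact hfin.biUnion fun d _ => List.finite_toSet d
    · rintro c ⟨_, ⟨x, hx, rfl⟩, hc⟩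
      exact hDC _ (hg x hx) c hc
  have nil_notMem_of : ∀ {D : Set (List (List A))}, D ≠ {[]} →
      (∀ v ∈ D, [] ∈ D → [] = v) → [] ∉ D := by
    intro D hD h h0
    exact hD (Set.eq_singleton_iff_unique_mem.2 ⟨h0, fun v hv => (h v hv h0).symm⟩)
  induction hC with
  | base =>
    intro F _ hF
    refine ⟨_, hF, Set.finite_range _, uniquelyDecodable_of_prefixFree ?_ ?_, ?_⟩
    · rintro ⟨x, hx⟩
      simp at hx
    · rintro _ ⟨x, rfl⟩ _ ⟨y, rfl⟩ h
      exact h.eq_of_length rfl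
    · refine fun w => ⟨[], [], w.map fun x => [x], ?_, ?_⟩
      · intro v hv
        obtain ⟨x, -, rfl⟩ := List.mem_map.1 hv
        exact ⟨x, rfl⟩
      · induction w with
        | nil => rfl
        | cons x w ih =>
          rw [List.map_cons, List.flatten_cons, ← ih]
          rfl
  | prefixStep _ hD ih =>
    obtain ⟨D, hDC, ⟨hD1, hD2⟩, rfl⟩ := hD
    intro F hF hFD
    obtain ⟨D₀, h1, h2, h3, h4, h5⟩ := lift hF hFD hDC
    obtain ⟨M, hM1, hM2, hM3, hM4⟩ := ih _ h4 h5
    have h0 := nil_notMem_of hD1 fun v hv h0 => hD2 _ h0 v hv List.nil_prefix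
    -- The completion is taken over the alphabet `M`, the finite complete code found one level down,
    -- rather than over the original code.
    obtain ⟨D', e1, e2, e3, e4, e5⟩ := exists_complete_prefixCode hM2 h2
      (fun d hd c hc => hM1 ⟨d, hd, hc⟩) (fun h => h0 (h1 h))
      fun u hu v hv => hD2 u (h1 hu) v (h1 hv)
    refine ⟨List.flatten '' D', h3.trans (Set.image_mono e1), e2.image _,
      uniquelyDecodable_flatten hM3 e4 e3, hM4.flatten fun w hw => ?_⟩
    obtain ⟨v, hv⟩ := e5 w hw
    exact ⟨[], v, by simpa using hv⟩
  | suffixStep _ hD ih =>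
    obtain ⟨D, hDC, ⟨hD1, hD2⟩, rfl⟩ := hD
    intro F hF hFD
    obtain ⟨D₀, h1, h2, h3, h4, h5⟩ := lift hF hFD hDC
    obtain ⟨M, hM1, hM2, hM3, hM4⟩ := ih _ h4 h5
    have h0 := nil_notMem_of hD1 fun v hv h0 => hD2 _ h0 v hv List.nil_suffix
    obtain ⟨D', e1, e2, e3, e4, e5⟩ := exists_complete_suffixCode hM2 h2
      (fun d hd c hc => hM1 ⟨d, hd, hc⟩) (fun h => h0 (h1 h))
      fun u hu v hv => hD2 u (h1 hu) v (h1 hv)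
    refine ⟨List.flatten '' D', h3.trans (Set.image_mono e1), e2.image _,
      uniquelyDecodable_flatten hM3 e4 e3, hM4.flatten fun w hw => ?_⟩
    obtain ⟨v, hv⟩ := e5 w hw
    exact ⟨v, [], by simpa using hv⟩

/-- By `eq_of_modEq` the exponents modulo `n` determine a word of `X`, which leaves at most `n * n`
words. -/
theorem finite_of_uniquelyDecodable {a : A} {n : ℕ} (hn : 0 < n) {ω : List A}
    (hω : ∀ k, ω ≠ apow a k) {X : Set (List A)} (hX : ∀ x ∈ X, ∃ i j, x = pad a i ω j)
    (hcode : UniquelyDecodable ({apow a n} ∪ X)) : X.Finite := by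
  have h1 : {x : ℕ × ℕ | pad a x.1 ω x.2 ∈ X}.Finite := by
    refine Set.Finite.of_finite_image (f := fun x => (x.1 % n, x.2 % n)) ?_ ?_
    · refine ((Set.finite_Iio n).prod (Set.finite_Iio n)).subset ?_
      rintro _ ⟨x, -, rfl⟩
      exact ⟨Nat.mod_lt _ hn, Nat.mod_lt _ hn⟩
    · intro x hx y hy he
      simp only [Prod.mk.injEq] at he
      obtain ⟨e1, e2⟩ := eq_of_modEq hω hcode hx hy he.1 he.2
      exact Prod.ext e1 e2
  refine (h1.image fun x => pad a x.1 ω x.2).subset fun w hw => ?_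
  obtain ⟨i, j, rfl⟩ := hX w hw
  exact ⟨(i, j), hw, rfl⟩

end BayonetCode

theorem mainTheorem7 {A : Type*} [Finite A] (a b : A) (hab : a ≠ b)
    (n : ℕ) (hn : BayonetCode.IsCbcHajosNumber a b n)
    (ω : List A) (hω : ∀ k : ℕ, ω ≠ BayonetCode.apow a k)
    (X : Set (List A)) (hX : ∀ x ∈ X, ∃ i j : ℕ, x = BayonetCode.pad a i ω j)
    (hcode : InformationTheory.UniquelyDecodable ({BayonetCode.apow a n} ∪ X)) :
    List.TFAE [
      ∃ M : Set (List A), BayonetCode.IsFiniteMaximalCode M ∧ {BayonetCode.apow a n} ∪ X ⊆ M,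
      ∃ Y : Set (List A), BayonetCode.IsCbc a b n Y ∧ BayonetCode.cSet a b n X ω ⊆ Y,
      ∃ Y : Set (List A), BayonetCode.IsHajosCbc a b n Y ∧ BayonetCode.cSet a b n X ω ⊆ Y,
      BayonetCode.IsPrefixSuffixCode ({BayonetCode.apow a n} ∪ X)] := by
  have hn0 : 0 < n := hn.1
  tfae_have 1 → 2 := by
    rintro ⟨M, ⟨hfin, hmax⟩, hsub⟩
    have ha : BayonetCode.apow a n ∈ M := hsub (Or.inl rfl)
    have hcomp := BayonetCode.isComplete_of_maximal hab hmax
    refine ⟨_, BayonetCode.isCbc_cSet hab hn0 hmax.prop ha (BayonetCode.card_rel_eq hn0 hfin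
      hmax.prop ha (hcomp.rel_nonempty hn0 hfin) ω), ?_⟩
    rintro _ ⟨i, j, hij, rfl⟩
    exact ⟨i, j, BayonetCode.star_mono (fun x hx => hsub (Or.inr hx)) hij, rfl⟩
  tfae_have 2 → 3 := by
    rintro ⟨Y, hY, hsub⟩
    exact ⟨Y, hn.isHajosCbc hab hY, hsub⟩
  tfae_have 3 → 4 := by
    rintro ⟨Y, hY, hsub⟩
    exact hY.isPrefixSuffixCode_of_cSet_subset hab hn0 hω hX hcode hsub
  tfae_have 4 → 1 := by
    intro h
    obtain ⟨M, hsub, hfin, hUD, hcomp⟩ := h.exists_complete _ ((Set.finite_singleton _).union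
      (BayonetCode.finite_of_uniquelyDecodable hn0 hω hX hcode)) subset_rfl
    exact ⟨M, hcomp.isFiniteMaximalCode hn0 hfin hUD (hsub (Or.inl rfl)), hsub⟩
  tfae_finish
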